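/- **Setting.** Let $V,U,H,Z,W$ be real Hilbert spaces with $V$ separable and continuously embedded in $Z$ and in $W$, and let $(\Omega,\mathcal F,\mathbb P)$ be a probability space. For $\omega\in\Omega$ let $a_\omega:V\times V\to\mathbb R$ be a continuous bilinear form, coercive for a.e. $\omega$, with $\omega\mapsto a_\omega(y,v)$ measurable for all $y,v\in V$. For $f\in V'$ let $S^\omega f,\,S^{\omega,\star}f\in V$ be the solutions of $a_\omega(S^\omega f,v)=\langle f,v\rangle$ and $a_\omega(v,S^{\omega,\star}f)=\langle f,v\rangle$ for all $v\in V$, and assume $\|S^\omega f\|_V\le C_S(\omega)\|f\|_{V'}$ for a.e. $\omega$ and all $f$, with $C_S\in L^q(\Omega)$ for all $q\in[1,\infty)$. Let $V_\ell\subset V$ ($\ell\ge 0$) be finite dimensional subspaces with mesh sizes $h_\ell>0$ such that $\sup_\ell h_\ell<\infty$ and $\sup_{\ell\ge1}h_{\ell-1}/h_\ell<\infty$, and let $S^\omega_\ell f,\,S^{\omega,\star}_\ell f\in V_\ell$ be the solutions of the same equations with $V$ replaced by $V_\ell$. Let $\mathcal B:U\to Z'$ and $\mathcal C:W\to H$ be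 linear and continuous, $y_d\in H$, $\nu>0$; write $\Lambda_U,\Lambda_H$ for the Riesz isomorphisms, and $$p^\omega(u)=S^{\omega,\star}\mathcal C^\star\Lambda_H(y_d-\mathcal C S^\omega\mathcal B u),\qquad p_\ell^\omega(u)=S_\ell^{\omega,\star}\mathcal C^\star\Lambda_H(y_d-\mathcal C S_\ell^\omega\mathcal B u).$$ **Quadrature.** Let $\mathcal Q^k[f]=\sum_{j=1}^{N_k}\zeta^k_j f(\xi^k_j)$, $k\ge0$, where the nodes $\xi^k_j\in\Omega$ and the weights $\zeta_j^k>0$, $\sum_j\zeta^k_j=1$, are random variables on a second probability space, over which the outer expectation in the bounds below is taken. **Controls.** There are no control constraints ($U_{ad}=U$). Let $u^\star$, $u^\star_{\ell,\infty}$, $u^\star_{\ell,k}$ be the minimizers over $u\in U$ of $$\tfrac12\mathbb E\|\mathcal CS^\omega\mathcal Bu-y_d\|_H^2+\tfrac\nu2\|u\|_U^2,\quad \tfrac12\mathbb E\|\mathcal CS_\ell^\omega\mathcal Bu-y_d\|_H^2+\tfrac\nu2\|u\|_U^2,\quad \tfrac12\mathcal Q^k\big[\|\mathcal CS_\ell^\omega\mathcal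 Bu-y_d\|_H^2\big]+\tfrac\nu2\|u\|_U^2,$$ respectively. With the convention that terms with an index $-1$ vanish, put $$\Delta\mathcal Q^k[p_\ell(u^\star_{\ell,k})]=\mathcal Q^k[p_\ell(u^\star_{\ell,k})]-\mathcal Q^k[p_{\ell-1}(u^\star_{\ell-1,k})]-\mathcal Q^{k-1}[p_\ell(u^\star_{\ell,k-1})]+\mathcal Q^{k-1}[p_{\ell-1}(u^\star_{\ell-1,k-1})],$$ $$u^{MQ(L)}=\frac1\nu\Lambda_U^{-1}\mathcal B^\star\sum_{\ell=0}^L\sum_{k=0}^{L-\ell}\Delta\mathcal Q^k[p_\ell(u^\star_{\ell,k})].$$ **Assumptions.** 1. (Quadrature) The $\mathcal Q^k$ are unbiased ($\mathbb E\,\mathcal Q^k[f]=\mathbb E f$ for all $f\in L^1(\Omega)$) and statistically independent. There is a decreasing null sequence $(\gamma_k)$, and for every $q\in[2,\infty)$ a normed vector space $H_q(\Omega;Z)$ of integrable functions (identified when equal a.e.) and a constant $\widetilde C_q>0$ with $\big(\mathbb E\|\mathbb E f-\mathcal Q^k[f]\|_Z^q\big)^{1/q}\le\widetilde C_q\,\gamma_k\|f\|_{H_q(\Omega;Z)}$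 for all $f\in H_q(\Omega;Z)$, $k\ge0$. 2. (Finite elements) There are $\alpha_W,\alpha_Z>0$ and $C_a,C_a^\star$ in $L^q(\Omega)$ for all $q\in[1,\infty)$ such that for a.e. $\omega$ and all $\ell\ge 0$, $u\in U$, $g\in H$, $$\|(S^\omega-S^\omega_\ell)\mathcal Bu\|_W\le C_a(\omega)h_\ell^{\alpha_W}\|u\|_U,\qquad \|(S^{\omega,\star}-S^{\omega,\star}_\ell)\mathcal C^\star\Lambda_Hg\|_Z\le C^\star_a(\omega)h_\ell^{\alpha_Z}\|g\|_H.$$ 3. (Mixed regularity) There are $\bar q\in(2,\infty)$, $\widetilde\alpha>0$ and constants $C_{H,q}>0$ such that for every $q\in[2,\bar q]$ one has $p(u),p_\ell(u)\in H_q(\Omega;Z)$ for all $u\in U$, $\ell\ge0$, and $$\|p(u^\star)-p_\ell(u^\star_{\ell,\infty})\|_{H_q(\Omega;Z)}\le C_{H,q}h_\ell^{\widetilde\alpha}(\|u^\star\|_U+\|y_d\|_H)\quad\text{for all }\ell\ge0.$$ **Theorem (Error of the multilevel approximation).** Put $\alpha=\min(\alpha_W,\alpha_Z)$ and $\beta=\min(\alpha,\widetilde\alpha)$.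 Under assumptions 1–3 there are constants $C_1,C_3>0$, independent of $L$, such that for every integer $L\ge0$ the random variable $\|u^\star-u^{MQ(L)}\|_U^2$ is integrable and $$\mathbb E\,\|u^\star-u^{MQ(L)}\|_U^2\le 2C_1^2h_L^{2\alpha}+C_3^2\,L\sum_{\ell=0}^Lh_\ell^{2\beta}\gamma_{L-\ell}^2 .$$ -/

import Mathlib

open MeasureTheory ProbabilityTheory Filter Topology

noncomputable section

namespace MLQ

/-- The Galerkin solution in the subspace `K` of the variational problem `b(y, v) = f(v)`:
the element `y` of `K` with `b y v = f v` for all `v` in `K`. For a continuous coercive form `b`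
and a closed subspace `K` of a Hilbert space it exists and is unique (Lax-Milgram); the value is
`0` if there is no solution. With `K = ⊤` it is the exact solution, and with `b.flip` in place of
`b` it is the solution of the adjoint problem `b(v, y) = f(v)`. -/
def galerkinSol {V : Type*} [NormedAddCommGroup V] [InnerProductSpace ℝ V]
    (K : Submodule ℝ V) (b : V →L[ℝ] V →L[ℝ] ℝ) (f : V →L[ℝ] ℝ) : V :=
  open Classical in
  if h : ∃ y ∈ K, ∀ v ∈ K, b y v = f v then h.choose else 0

/-- A minimizer over the whole space of a functional `J`. All functionals to which it is
applied below have (almost surely) exactly one minimizer. -/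
def minimizer {U : Type*} [NormedAddCommGroup U] (J : U → ℝ) : U :=
  Classical.epsilon fun u => ∀ v, J u ≤ J v

/-- The linear-quadratic optimal control problem constrained by a random linear elliptic
equation, without control constraints: `V` is the state space, `U` the control space, `H` the
observation space, and `Z`, `W` are larger Hilbert spaces into which `V` is continuously
embedded. -/
structure RandomOCP {Ω : Type*} [MeasurableSpace Ω] (P : Measure Ω)
    (V U H Z W : Type*)
    [NormedAddCommGroup V] [InnerProductSpace ℝ V]
    [NormedAddCommGroup U] [InnerProductSpace ℝ U]
    [NormedAddCommGroup H] [InnerProductSpace ℝ H]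
    [NormedAddCommGroup Z] [InnerProductSpace ℝ Z]
    [NormedAddCommGroup W] [InnerProductSpace ℝ W] where
  /-- the random continuous bilinear form -/
  a : Ω → V →L[ℝ] V →L[ℝ] ℝ
  a_meas : ∀ y v : V, AEMeasurable (fun ω => a ω y v) P
  a_coercive : ∀ᵐ ω ∂P, IsCoercive (a ω)
  /-- a continuity constant of the solution operator, with moments of all orders -/
  CS : Ω → ℝ
  CS_memLp : ∀ q : ℝ, 1 ≤ q → MemLp CS (ENNReal.ofReal q) P
  CS_bound : ∀ᵐ ω ∂P, ∀ f : V →L[ℝ] ℝ, ‖galerkinSol ⊤ (a ω) f‖ ≤ CS ω * ‖f‖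
  /-- the embedding of `V` into `Z` -/
  iZ : V →L[ℝ] Z
  iZ_injective : Function.Injective iZ
  /-- the embedding of `V` into `W` -/
  iW : V →L[ℝ] W
  iW_injective : Function.Injective iW
  /-- the control operator, with values in the dual of `Z` -/
  B : U →L[ℝ] Z →L[ℝ] ℝ
  /-- the observation operator, defined on `W` -/
  C : W →L[ℝ] H
  /-- the target state -/
  yd : H
  /-- the regularization parameter -/
  ν : ℝ
  ν_pos : 0 < ν

/-- A family of finite dimensional subspaces of `V` with mesh sizes `h l`. The mesh sizes are
bounded, as mesh sizes of triangulations of a bounded domain are, and two consecutive ones have a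
bounded ratio. -/
structure FEFamily (V : Type*) [NormedAddCommGroup V] [InnerProductSpace ℝ V] where
  /-- the mesh sizes -/
  h : ℕ → ℝ
  h_pos : ∀ l, 0 < h l
  h_bdd : BddAbove (Set.range h)
  ratio_bdd : ∃ τ : ℝ, ∀ l, h l / h (l + 1) ≤ τ
  /-- the finite element spaces -/
  space : ℕ → Submodule ℝ V
  finDim : ∀ l, FiniteDimensional ℝ (space l)

/-- A sequence of randomized quadrature formulae on `Ω`: the nodes and the positive weights,
which sum up to one, are random variables on a second probability space `(Ω', P')`. -/
structure RandomQuadrature (Ω : Type*) [MeasurableSpace Ω]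
    {Ω' : Type*} [MeasurableSpace Ω'] (P' : Measure Ω') where
  /-- the number of nodes -/
  N : ℕ → ℕ
  /-- the nodes -/
  ξ : (k : ℕ) → Fin (N k) → Ω' → Ω
  /-- the weights -/
  ζ : (k : ℕ) → Fin (N k) → Ω' → ℝ
  ξ_meas : ∀ k j, Measurable (ξ k j)
  ζ_meas : ∀ k j, Measurable (ζ k j)
  ζ_pos : ∀ k j, ∀ᵐ ω' ∂P', 0 < ζ k j ω'
  ζ_sum : ∀ k, ∀ᵐ ω' ∂P', ∑ j, ζ k j ω' = 1

/-- The value `Q^k[f]` of the `k`-th formula; it is random. -/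
def RandomQuadrature.eval {Ω : Type*} [MeasurableSpace Ω]
    {Ω' : Type*} [MeasurableSpace Ω'] {P' : Measure Ω'} (Q : RandomQuadrature Ω P')
    {E : Type*} [AddCommGroup E] [Module ℝ E] (k : ℕ) (f : Ω → E) (ω' : Ω') : E :=
  ∑ j, Q.ζ k j ω' • f (Q.ξ k j ω')

/-- A normed vector space of integrable functions from `Ω` to `Z`. The norm is allowed to be a
seminorm on functions, since functions that agree almost everywhere may be identified. -/
structure FunctionSpace {Ω : Type*} [MeasurableSpace Ω] (P : Measure Ω)
    (Z : Type*) [NormedAddCommGroup Z] [NormedSpace ℝ Z] where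
  /-- the functions of the space -/
  carrier : Submodule ℝ (Ω → Z)
  /-- the norm of the space -/
  nrm : Seminorm ℝ carrier
  integrable : ∀ f ∈ carrier, Integrable f P

namespace RandomOCP

variable {Ω : Type*} [MeasurableSpace Ω] {P : Measure Ω}
  {V U H Z W : Type*}
  [NormedAddCommGroup V] [InnerProductSpace ℝ V]
  [NormedAddCommGroup U] [InnerProductSpace ℝ U]
  [NormedAddCommGroup H] [InnerProductSpace ℝ H]
  [NormedAddCommGroup Z] [InnerProductSpace ℝ Z]
  [NormedAddCommGroup W] [InnerProductSpace ℝ W]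
  (prob : RandomOCP P V U H Z W)

/-- The functional `B u`, restricted to `V`. -/
def load (u : U) : V →L[ℝ] ℝ := (prob.B u).comp prob.iZ

/-- The observation operator on `V`. -/
def obs : V →L[ℝ] H := prob.C.comp prob.iW

/-- The functional `C^⋆ Λ_H g`, that is, `v ↦ ⟪g, C v⟫`. -/
def obsDual (g : H) : V →L[ℝ] ℝ := (innerSL ℝ g).comp prob.obs

/-- The state `S^ω B u`, computed in the subspace `K` (`K = ⊤` for the exact one). -/
def state (K : Submodule ℝ V) (ω : Ω) (u : U) : V :=
  galerkinSol K (prob.a ω) (prob.load u)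

/-- The operator `S^{ω,⋆} C^⋆ Λ_H`, computed in the subspace `K`. -/
def adjointObs (K : Submodule ℝ V) (ω : Ω) (g : H) : V :=
  galerkinSol K (prob.a ω).flip (prob.obsDual g)

/-- The adjoint variable `p^ω(u) = S^{ω,⋆} C^⋆ Λ_H (y_d - C S^ω B u)`, computed in the
subspace `K` and regarded as an element of `Z`. -/
def adjointVar (K : Submodule ℝ V) (u : U) (ω : Ω) : Z :=
  prob.iZ (prob.adjointObs K ω (prob.yd - prob.obs (prob.state K ω u)))

/-- The functional `1/2 E ‖C S^ω B u - y_d‖² + ν/2 ‖u‖²`, with states computed in `K`. -/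
def J (K : Submodule ℝ V) (u : U) : ℝ :=
  1 / 2 * (∫ ω, ‖prob.obs (prob.state K ω u) - prob.yd‖ ^ 2 ∂P) + prob.ν / 2 * ‖u‖ ^ 2

/-- The optimal control `u^⋆` if `K = ⊤`, and the optimal control `u^⋆_{l,∞}` of the problem
that is discretized in space only if `K` is the `l`-th finite element space. -/
def optControl (K : Submodule ℝ V) : U := minimizer (prob.J K)

variable {Ω' : Type*} [MeasurableSpace Ω'] {P' : Measure Ω'} (Q : RandomQuadrature Ω P')

/-- The fully discretized functional
`1/2 Q^k[‖C S^ω B u - y_d‖²] + ν/2 ‖u‖²`, with states computed in `K`. -/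
def Jquad (K : Submodule ℝ V) (k : ℕ) (ω' : Ω') (u : U) : ℝ :=
  1 / 2 * Q.eval k (fun ω => ‖prob.obs (prob.state K ω u) - prob.yd‖ ^ 2) ω'
    + prob.ν / 2 * ‖u‖ ^ 2

/-- The optimal control `u^⋆_{l,k}` of the fully discretized problem. -/
def optControlQuad (K : Submodule ℝ V) (k : ℕ) (ω' : Ω') : U :=
  minimizer (prob.Jquad Q K k ω')

variable (fe : FEFamily V)

/-- `Q^k[p_l(u^⋆_{l,k})]`, with both indices shifted by one: the value at `(l + 1, k + 1)` is the
one of level `(l, k)`, and the value is `0` if one of the shifted indices is `0`. -/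
def shiftedAdjoint : ℕ → ℕ → Ω' → Z
  | l + 1, k + 1, ω' =>
      Q.eval k (prob.adjointVar (fe.space l) (prob.optControlQuad Q (fe.space l) k ω')) ω'
  | _, _, _ => 0

/-- The hierarchical surplus `ΔQ^k[p_l(u^⋆_{l,k})]`. -/
def surplus (l k : ℕ) (ω' : Ω') : Z :=
  prob.shiftedAdjoint Q fe (l + 1) (k + 1) ω' - prob.shiftedAdjoint Q fe l (k + 1) ω'
    - prob.shiftedAdjoint Q fe (l + 1) k ω' + prob.shiftedAdjoint Q fe l k ω'

/-- The multilevel quadrature control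
`u^{MQ(L)} = ν⁻¹ Λ_U⁻¹ B^⋆ ∑_{l ≤ L} ∑_{k ≤ L - l} ΔQ^k[p_l(u^⋆_{l,k})]`. -/
def uMQ [CompleteSpace U] (L : ℕ) (ω' : Ω') : U :=
  (1 / prob.ν) • (InnerProductSpace.toDual ℝ U).symm
    (prob.B.flip
      (∑ l ∈ Finset.range (L + 1), ∑ k ∈ Finset.range (L - l + 1), prob.surplus Q fe l k ω'))

end RandomOCP

/-- The quadrature assumption: the formulae are unbiased, statistically independent, and for
every `q ≥ 2` their error in `L^q` is at most a constant times `γ k ‖f‖` for all `f` in the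
space `Hq q`, where `γ` is a decreasing null sequence. -/
structure QuadratureAssumption {Ω : Type*} [MeasurableSpace Ω] (P : Measure Ω)
    {Ω' : Type*} [MeasurableSpace Ω'] (P' : Measure Ω')
    {Z : Type*} [NormedAddCommGroup Z] [NormedSpace ℝ Z]
    (Q : RandomQuadrature Ω P') (Hq : ℝ → FunctionSpace P Z) (γ : ℕ → ℝ) : Prop where
  unbiased : ∀ (k : ℕ) (f : Ω → ℝ), Integrable f P →
    Integrable (Q.eval k f) P' ∧ ∫ ω', Q.eval k f ω' ∂P' = ∫ ω, f ω ∂P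
  indep : iIndepFun (fun (k : ℕ) (ω' : Ω') (j : Fin (Q.N k)) => (Q.ξ k j ω', Q.ζ k j ω')) P'
  γ_antitone : Antitone γ
  γ_null : Tendsto γ atTop (𝓝 0)
  bound : ∀ q : ℝ, 2 ≤ q → ∃ CQ : ℝ, 0 < CQ ∧ ∀ (f : (Hq q).carrier) (k : ℕ),
    eLpNorm (fun ω' => (∫ ω, (f : Ω → Z) ω ∂P) - Q.eval k (f : Ω → Z) ω') (ENNReal.ofReal q) P'
      ≤ ENNReal.ofReal (CQ * γ k * (Hq q).nrm f)

/-- The finite element assumption, with rates `αW` for the states and `αZ` for the adjoints. -/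
structure FEAssumption {Ω : Type*} [MeasurableSpace Ω] {P : Measure Ω}
    {V U H Z W : Type*}
    [NormedAddCommGroup V] [InnerProductSpace ℝ V]
    [NormedAddCommGroup U] [InnerProductSpace ℝ U]
    [NormedAddCommGroup H] [InnerProductSpace ℝ H]
    [NormedAddCommGroup Z] [InnerProductSpace ℝ Z]
    [NormedAddCommGroup W] [InnerProductSpace ℝ W]
    (prob : RandomOCP P V U H Z W) (fe : FEFamily V) (αW αZ : ℝ) : Prop where
  αW_pos : 0 < αW
  αZ_pos : 0 < αZ
  forward : ∃ Ca : Ω → ℝ, (∀ q : ℝ, 1 ≤ q → MemLp Ca (ENNReal.ofReal q) P) ∧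
    ∀ᵐ ω ∂P, ∀ (l : ℕ) (u : U),
      ‖prob.iW (prob.state ⊤ ω u - prob.state (fe.space l) ω u)‖ ≤ Ca ω * fe.h l ^ αW * ‖u‖
  adjoint : ∃ Ca : Ω → ℝ, (∀ q : ℝ, 1 ≤ q → MemLp Ca (ENNReal.ofReal q) P) ∧
    ∀ᵐ ω ∂P, ∀ (l : ℕ) (g : H),
      ‖prob.iZ (prob.adjointObs ⊤ ω g - prob.adjointObs (fe.space l) ω g)‖
        ≤ Ca ω * fe.h l ^ αZ * ‖g‖

/-- The mixed-regularity assumption, with rate `αt`. Membership of a function in `Hq q` is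
understood up to almost everywhere equality. -/
structure MixedRegularity {Ω : Type*} [MeasurableSpace Ω] {P : Measure Ω}
    {V U H Z W : Type*}
    [NormedAddCommGroup V] [InnerProductSpace ℝ V]
    [NormedAddCommGroup U] [InnerProductSpace ℝ U]
    [NormedAddCommGroup H] [InnerProductSpace ℝ H]
    [NormedAddCommGroup Z] [InnerProductSpace ℝ Z]
    [NormedAddCommGroup W] [InnerProductSpace ℝ W]
    (prob : RandomOCP P V U H Z W) (fe : FEFamily V) (Hq : ℝ → FunctionSpace P Z)
    (αt : ℝ) : Prop where
  αt_pos : 0 < αt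
  mixed : ∃ qbar : ℝ, 2 < qbar ∧ ∀ q ∈ Set.Icc 2 qbar,
    (∀ u : U, ∃ g : (Hq q).carrier, (g : Ω → Z) =ᵐ[P] prob.adjointVar ⊤ u) ∧
    (∀ (l : ℕ) (u : U), ∃ g : (Hq q).carrier,
      (g : Ω → Z) =ᵐ[P] prob.adjointVar (fe.space l) u) ∧
    ∃ CH : ℝ, 0 < CH ∧ ∀ l : ℕ, ∃ g : (Hq q).carrier,
      ((g : Ω → Z) =ᵐ[P] fun ω => prob.adjointVar ⊤ (prob.optControl ⊤) ω
        - prob.adjointVar (fe.space l) (prob.optControl (fe.space l)) ω) ∧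
      (Hq q).nrm g ≤ CH * fe.h l ^ αt * (‖prob.optControl ⊤‖ + ‖prob.yd‖)

end MLQ

end

/-!
The double sum in `u^{MQ(L)}` telescopes in the quadrature index, and the optimality condition
`ν u = Λ_U⁻¹ B^⋆ Q^k[p_l(u)]` of the fully discretized problems identifies the remaining terms, so
that `u^{MQ(L)} = ∑ l ≤ L, (u_{l,L-l} - u_{l-1,L-l})`, where `u_{l,k}` is the control optimal for
level `l` and the `k`-th formula. With `e_{l,k} = u_{l,∞} - u_{l,k}` it follows that
`u^⋆ - u^{MQ(L)} = (u^⋆ - u_{L,∞}) + ∑ l ≤ L, (e_{l,L-l} - e_{l-1,L-l})`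
(`ae_optControl_sub_uMQ`).

In terms of the control-to-observation operators `T_l = C S_l B`, the first summand is bounded by
`h_L ^ α`, since the normal operators `ν + E[T_l^⋆ T_l]` are coercive with constant `ν` and `T_l`
converges at this rate (`IsReduced.norm_minimizer_sub_le`).

The quadrature error `e_{l,k}` solves
`(ν + Q^k[T_l^⋆ T_l]) e_{l,k} = Λ_U⁻¹ B^⋆ (E - Q^k)[p_l(u_{l,∞})]`. Subtracting two such equations
bounds `e_{l,k} - e_{l-1,k}` by the quadrature error of `p_l(u_{l,∞}) - p_{l-1}(u_{l-1,∞})`, which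
is of order `h_l ^ β γ_k` by mixed regularity, plus `Q^k[‖T_l^⋆ T_l - T_{l-1}^⋆ T_{l-1}‖]` times the
quadrature error of `p_{l-1}(u_{l-1,∞})` (`IsReduced.ae_norm_quadrature_error_sub_le`). Both factors
of this product are random. Hölder's inequality separates them: the second one is of order `γ_k` in
`L^q` for some `q > 2`, and the first one is of order `h_l ^ α` in every `L^s`, because an unbiased
formula with positive weights is a contraction on `L^s` by Jensen's inequality
(`exists_levelError_le`).

Two measurability questions have to be settled, without separability of `U`, `H` or `Z`. The
observed states enter the functionals only through the duality relation
`⟨B v, p(u)⟩ = ⟪y_d - T u, T v⟫`, so the integrability of the adjoint variables suffices. The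
random controls `u_{l,k}` are measurable as limits of the Richardson iteration for their normal
equations (`aestronglyMeasurable_of_regularized`).
-/

namespace MLQ

/-! ### Galerkin solutions -/

section Galerkin

variable {V : Type*} [NormedAddCommGroup V] [InnerProductSpace ℝ V]

theorem isCoercive_flip {b : V →L[ℝ] V →L[ℝ] ℝ} (hb : IsCoercive b) : IsCoercive b.flip := hb

/-- The Lax-Milgram theorem on a complete subspace. -/
theorem exists_galerkin (K : Submodule ℝ V) [CompleteSpace K] {b : V →L[ℝ] V →L[ℝ] ℝ}
    (hb : IsCoercive b) (f : V →L[ℝ] ℝ) : ∃ y ∈ K, ∀ v ∈ K, b y v = f v := by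
  obtain ⟨c, hc, hcb⟩ := hb
  have hb' : IsCoercive (b.bilinearComp K.subtypeL K.subtypeL) := ⟨c, hc, fun u => hcb u⟩
  refine ⟨hb'.continuousLinearEquivOfBilin.symm
    ((InnerProductSpace.toDual ℝ K).symm (f.comp K.subtypeL)), Submodule.coe_mem _, ?_⟩
  intro v hv
  have h := hb'.continuousLinearEquivOfBilin_apply (hb'.continuousLinearEquivOfBilin.symm
    ((InnerProductSpace.toDual ℝ K).symm (f.comp K.subtypeL))) ⟨v, hv⟩
  rw [ContinuousLinearEquiv.apply_symm_apply, InnerProductSpace.toDual_symm_apply] at h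
  simpa using h.symm

theorem galerkinSol_mem (K : Submodule ℝ V) (b : V →L[ℝ] V →L[ℝ] ℝ) (f : V →L[ℝ] ℝ) :
    galerkinSol K b f ∈ K := by
  unfold galerkinSol
  split_ifs with h
  · exact h.choose_spec.1
  · exact K.zero_mem

theorem galerkinSol_spec (K : Submodule ℝ V) [CompleteSpace K] {b : V →L[ℝ] V →L[ℝ] ℝ}
    (hb : IsCoercive b) (f : V →L[ℝ] ℝ) {v : V} (hv : v ∈ K) : b (galerkinSol K b f) v = f v := by
  have h := exists_galerkin K hb f
  unfold galerkinSol
  rw [dif_pos h]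
  exact h.choose_spec.2 v hv

theorem galerkinSol_unique (K : Submodule ℝ V) [CompleteSpace K] {b : V →L[ℝ] V →L[ℝ] ℝ}
    (hb : IsCoercive b) (f : V →L[ℝ] ℝ) {y : V} (hy : y ∈ K) (h : ∀ v ∈ K, b y v = f v) :
    galerkinSol K b f = y := by
  have hz : galerkinSol K b f - y ∈ K := K.sub_mem (galerkinSol_mem K b f) hy
  have h0 : b (galerkinSol K b f - y) (galerkinSol K b f - y) = 0 := by
    rw [map_sub b, sub_apply, galerkinSol_spec K hb f hz, h _ hz, sub_self]
  obtain ⟨c, hc, hcb⟩ := hb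
  have h1 := hcb (galerkinSol K b f - y)
  rw [h0, mul_assoc] at h1
  have h2 : ‖galerkinSol K b f - y‖ * ‖galerkinSol K b f - y‖ = 0 :=
    le_antisymm (nonpos_of_mul_nonpos_right h1 hc) (mul_self_nonneg _)
  exact sub_eq_zero.1 (norm_eq_zero.1 (mul_self_eq_zero.1 h2))

/-- The Galerkin solution depends linearly and continuously on the data. -/
theorem exists_galerkinSol_clm (K : Submodule ℝ V) [CompleteSpace K] {b : V →L[ℝ] V →L[ℝ] ℝ}
    (hb : IsCoercive b) :
    ∃ S : (V →L[ℝ] ℝ) →L[ℝ] V, ∀ f, S f = galerkinSol K b f := by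
  obtain ⟨c, hc, hcb⟩ := id hb
  refine ⟨LinearMap.mkContinuous
    { toFun := galerkinSol K b
      map_add' := fun f g => ?_
      map_smul' := fun t f => ?_ } c⁻¹ fun f => ?_, fun f => rfl⟩
  · refine galerkinSol_unique K hb _ (K.add_mem (galerkinSol_mem ..) (galerkinSol_mem ..)) ?_
    intro v hv
    simp [galerkinSol_spec K hb _ hv]
  · refine galerkinSol_unique K hb _ (K.smul_mem _ (galerkinSol_mem ..)) ?_
    intro v hv
    simp [galerkinSol_spec K hb _ hv]
  · change ‖galerkinSol K b f‖ ≤ _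
    have h1 := hcb (galerkinSol K b f)
    rw [galerkinSol_spec K hb f (galerkinSol_mem ..)] at h1
    have h2 := (le_abs_self _).trans (f.le_opNorm (galerkinSol K b f))
    rcases (norm_nonneg (galerkinSol K b f)).eq_or_lt with h | h
    · rw [← h]; positivity
    · have h3 := le_of_mul_le_mul_right (h1.trans h2) h
      rw [inv_mul_eq_div, le_div_iff₀ hc]
      linarith

end Galerkin

namespace RandomOCP

variable {Ω : Type*} [MeasurableSpace Ω] {P : Measure Ω}
  {V U H Z W : Type*}
  [NormedAddCommGroup V] [InnerProductSpace ℝ V]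
  [NormedAddCommGroup U] [InnerProductSpace ℝ U]
  [NormedAddCommGroup H] [InnerProductSpace ℝ H]
  [NormedAddCommGroup Z] [InnerProductSpace ℝ Z]
  [NormedAddCommGroup W] [InnerProductSpace ℝ W]
  (prob : RandomOCP P V U H Z W)

/-- The control-to-observation operator `C S^ω B`, with states computed in `K`, as a continuous
linear operator; it is `0` at the parameters `ω` where the map `u ↦ C S^ω B u` is not continuous
and linear, which is nowhere the case if `a ω` is coercive and `K` complete. -/
noncomputable def ctrlToObs (K : Submodule ℝ V) (ω : Ω) : U →L[ℝ] H :=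
  open Classical in
  if h : ∃ T : U →L[ℝ] H, ∀ u, T u = prob.obs (prob.state K ω u) then h.choose else 0

theorem ctrlToObs_apply (K : Submodule ℝ V) [CompleteSpace K] {ω : Ω}
    (hω : IsCoercive (prob.a ω)) (u : U) :
    prob.ctrlToObs K ω u = prob.obs (prob.state K ω u) := by
  have h : ∃ T : U →L[ℝ] H, ∀ u, T u = prob.obs (prob.state K ω u) := by
    obtain ⟨S, hS⟩ := exists_galerkinSol_clm K hω
    exact ⟨prob.obs.comp (S.comp (((ContinuousLinearMap.compL ℝ V Z ℝ).flip prob.iZ).comp prob.B)),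
      fun u => congrArg prob.obs (hS _)⟩
  unfold ctrlToObs
  rw [dif_pos h]
  exact h.choose_spec u

/-- Duality of the state equation and the adjoint equation: tested with a control, the adjoint
variable is the derivative of the misfit. -/
theorem B_adjointVar (K : Submodule ℝ V) [CompleteSpace K] {ω : Ω}
    (hω : IsCoercive (prob.a ω)) (u v : U) :
    prob.B v (prob.adjointVar K u ω)
      = inner ℝ (prob.yd - prob.ctrlToObs K ω u) (prob.ctrlToObs K ω v) := by
  rw [ctrlToObs_apply prob K hω, ctrlToObs_apply prob K hω]
  set g := prob.yd - prob.obs (prob.state K ω u) with hg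
  have h1 : prob.a ω (prob.state K ω v) (prob.adjointObs K ω g)
      = prob.load v (prob.adjointObs K ω g) :=
    galerkinSol_spec K hω _ (galerkinSol_mem ..)
  have h2 : (prob.a ω).flip (prob.adjointObs K ω g) (prob.state K ω v)
      = prob.obsDual g (prob.state K ω v) :=
    galerkinSol_spec K (isCoercive_flip hω) _ (galerkinSol_mem ..)
  rw [ContinuousLinearMap.flip_apply, h1] at h2
  simpa [load, obsDual, adjointVar, ← hg] using h2

end RandomOCP

/-! ### Regularized quadratic functionals -/

section Quadratic

variable {U : Type*} [NormedAddCommGroup U] [InnerProductSpace ℝ U]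

/-- The solution `e` of `ν e + G e = r` with `G` positive semidefinite is bounded by the data. -/
theorem norm_le_of_regularized {ν : ℝ} {G : U →L[ℝ] U} (hG : ∀ u, 0 ≤ inner ℝ (G u) u)
    {e r : U} (h : ν • e + G e = r) : ν * ‖e‖ ≤ ‖r‖ := by
  have h1 : ν * ‖e‖ * ‖e‖ ≤ ‖r‖ * ‖e‖ := by
    calc ν * ‖e‖ * ‖e‖ = inner ℝ (ν • e) e := by
          rw [real_inner_smul_left, real_inner_self_eq_norm_mul_norm, mul_assoc]
      _ ≤ inner ℝ (ν • e + G e) e := by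
          rw [inner_add_left]; linarith [hG e]
      _ ≤ ‖r‖ * ‖e‖ := by rw [h]; exact real_inner_le_norm _ _
  rcases (norm_nonneg e).eq_or_lt with h0 | h0
  · rw [← h0]; simp
  · exact le_of_mul_le_mul_right h1 h0

/-- Stability of the solution of `ν e + G e = r` under perturbations of `G` and `r`; only one of the
two operators has to be positive semidefinite. -/
theorem norm_sub_le_of_regularized {ν : ℝ} {G G' : U →L[ℝ] U}
    (hG : ∀ u, 0 ≤ inner ℝ (G u) u) {e r e' r' : U}
    (h : ν • e + G e = r) (h' : ν • e' + G' e' = r') :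
    ν * ‖e - e'‖ ≤ ‖r - r'‖ + ‖G - G'‖ * ‖e'‖ := by
  have h1 : ν • (e - e') + G (e - e') = (r - r') - (G - G') e' := by
    rw [← h, ← h', map_sub, sub_apply, smul_sub]; abel
  exact (norm_le_of_regularized hG h1).trans
    ((norm_sub_le _ _).trans (add_le_add le_rfl ((G - G').le_opNorm e')))

/-- The minimizer of a regularized convex quadratic functional solves the normal equation. -/
theorem minimizer_spec [CompleteSpace U] {ν : ℝ} (hν : 0 < ν) {G : U →L[ℝ] U}
    (hsymm : ∀ u v, inner ℝ (G u) v = inner ℝ u (G v)) (hG : ∀ u, 0 ≤ inner ℝ (G u) u)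
    {g : U} {c : ℝ} {J : U → ℝ}
    (hJ : ∀ u, J u = 1 / 2 * inner ℝ (G u) u - inner ℝ g u + c + ν / 2 * ‖u‖ ^ 2) :
    ν • minimizer J + G (minimizer J) = g := by
  have hco : IsCoercive ((innerSL ℝ : U →L[ℝ] U →L[ℝ] ℝ).comp
      (ν • ContinuousLinearMap.id ℝ U + G)) := by
    refine ⟨ν, hν, fun u => ?_⟩
    have : inner ℝ (ν • u + G u) u = ν * ‖u‖ * ‖u‖ + inner ℝ (G u) u := by
      rw [inner_add_left, real_inner_smul_left, real_inner_self_eq_norm_mul_norm, mul_assoc]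
    simp only [ContinuousLinearMap.comp_apply, innerSL_apply_apply, add_apply,
      smul_apply, ContinuousLinearMap.id_apply, this]
    linarith [hG u]
  obtain ⟨u₀, -, hu₀⟩ := by
    have : CompleteSpace (⊤ : Submodule ℝ U) :=
      (isClosed_univ.isComplete).completeSpace_coe
    exact exists_galerkin ⊤ hco (innerSL ℝ g)
  have hu₀ : ν • u₀ + G u₀ = g := ext_inner_right ℝ fun v => hu₀ v trivial
  -- The functional exceeds its value at the solution by a quadratic remainder.
  have key : ∀ u, J u = J u₀ + (1 / 2 * inner ℝ (G (u - u₀)) (u - u₀)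
      + ν / 2 * ‖u - u₀‖ ^ 2) := by
    intro u
    have e1 : inner ℝ g u = ν * inner ℝ u₀ u + inner ℝ (G u₀) u := by
      rw [← hu₀, inner_add_left, real_inner_smul_left]
    have e2 : inner ℝ g u₀ = ν * inner ℝ u₀ u₀ + inner ℝ (G u₀) u₀ := by
      rw [← hu₀, inner_add_left, real_inner_smul_left]
    have e3 : inner ℝ (G u) u₀ = inner ℝ (G u₀) u := by rw [hsymm, real_inner_comm]
    rw [hJ, hJ, e1, e2]
    simp only [map_sub, inner_sub_left, inner_sub_right, ← real_inner_self_eq_norm_sq, e3]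
    rw [real_inner_comm u₀ u]
    ring
  have hmin : ∀ v, J u₀ ≤ J v := fun v => by
    rw [key v]
    have := hG (v - u₀)
    have : 0 ≤ ν / 2 * ‖v - u₀‖ ^ 2 := by positivity
    linarith
  have h1 : J (minimizer J) ≤ J u₀ :=
    Classical.epsilon_spec (p := fun u => ∀ v, J u ≤ J v) ⟨u₀, hmin⟩ u₀
  rw [key] at h1
  have h2 : ν / 2 * ‖minimizer J - u₀‖ ^ 2 ≤ 0 := by linarith [hG (minimizer J - u₀)]
  have h3 : ‖minimizer J - u₀‖ ^ 2 = 0 :=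
    le_antisymm (nonpos_of_mul_nonpos_right h2 (by positivity)) (by positivity)
  have h4 : minimizer J = u₀ := sub_eq_zero.1 (norm_eq_zero.1 (pow_eq_zero_iff two_ne_zero |>.1 h3))
  rw [h4, hu₀]

end Quadratic

/-! ### The Riesz representative of the adjoint control operator -/

section Riesz

variable {U Z : Type*} [NormedAddCommGroup U] [InnerProductSpace ℝ U] [CompleteSpace U]
  [NormedAddCommGroup Z] [NormedSpace ℝ Z]

/-- The operator `Λ_U⁻¹ B^⋆ : Z → U`. -/
noncomputable def rieszAdjoint (B : U →L[ℝ] Z →L[ℝ] ℝ) : Z →L[ℝ] U :=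
  LinearMap.mkContinuous
    { toFun := fun z => (InnerProductSpace.toDual ℝ U).symm (B.flip z)
      map_add' := fun x y => by simp
      map_smul' := fun t x => by simp }
    ‖B.flip‖ fun z => by simpa using B.flip.le_opNorm z

theorem rieszAdjoint_def (B : U →L[ℝ] Z →L[ℝ] ℝ) (z : Z) :
    (InnerProductSpace.toDual ℝ U).symm (B.flip z) = rieszAdjoint B z := rfl

theorem inner_rieszAdjoint (B : U →L[ℝ] Z →L[ℝ] ℝ) (z : Z) (u : U) :
    inner ℝ (rieszAdjoint B z) u = B u z := by
  rw [← rieszAdjoint_def, InnerProductSpace.toDual_symm_apply, ContinuousLinearMap.flip_apply]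

end Riesz

/-! ### Unbiased random quadrature -/

namespace RandomQuadrature

variable {Ω : Type*} [MeasurableSpace Ω] {P : Measure Ω}
  {Ω' : Type*} [MeasurableSpace Ω'] {P' : Measure Ω'}
  (Q : RandomQuadrature Ω P')

/-- The quadrature formulae integrate every integrable function exactly in the mean. -/
def Unbiased (P : Measure Ω) : Prop :=
  ∀ (k : ℕ) (f : Ω → ℝ), Integrable f P →
    Integrable (Q.eval k f) P' ∧ ∫ ω', Q.eval k f ω' ∂P' = ∫ ω, f ω ∂P

variable {Q}

/-- The nodes of an unbiased formula with positive weights almost surely avoid null sets: the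
formula, applied to the indicator function of a null set, is nonnegative with mean zero. -/
theorem Unbiased.quasiMeasurePreserving [IsFiniteMeasure P] (hQ : Q.Unbiased P) (k : ℕ)
    (j : Fin (Q.N k)) : Measure.QuasiMeasurePreserving (Q.ξ k j) P' P := by
  refine ⟨Q.ξ_meas k j, Measure.AbsolutelyContinuous.mk fun s hs h0 => ?_⟩
  rw [Measure.map_apply (Q.ξ_meas k j) hs]
  have hf : Integrable (s.indicator fun _ => (1 : ℝ)) P := (integrable_const 1).indicator hs
  obtain ⟨hi, he⟩ := hQ k _ hf
  rw [integral_indicator hs, Measure.restrict_eq_zero.2 h0, integral_zero_measure] at he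
  have hζ : ∀ᵐ ω' ∂P', ∀ i, 0 < Q.ζ k i ω' := ae_all_iff.2 (Q.ζ_pos k)
  have hterm : ∀ᵐ ω' ∂P', ∀ i,
      0 ≤ Q.ζ k i ω' • s.indicator (fun _ => (1 : ℝ)) (Q.ξ k i ω') := by
    filter_upwards [hζ] with ω' h i
    exact mul_nonneg (h i).le (Set.indicator_nonneg (fun _ _ => zero_le_one) _)
  have hz := (integral_eq_zero_iff_of_nonneg_ae
    (hterm.mono fun ω' h => Finset.sum_nonneg fun i _ => h i) hi).1 he
  refine measure_eq_zero_iff_ae_notMem.2 ?_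
  filter_upwards [hz, hterm, hζ] with ω' h1 h2 h3 hmem
  have h4 := (Finset.sum_eq_zero_iff_of_nonneg fun i _ => h2 i).1 h1 j (Finset.mem_univ j)
  rw [Set.indicator_of_mem (show Q.ξ k j ω' ∈ s from hmem)] at h4
  simp [(h3 j).ne'] at h4

theorem Unbiased.ae_nodes [IsFiniteMeasure P] (hQ : Q.Unbiased P) (k : ℕ) {p : Ω → Prop}
    (hp : ∀ᵐ ω ∂P, p ω) : ∀ᵐ ω' ∂P', ∀ j, p (Q.ξ k j ω') :=
  ae_all_iff.2 fun j => (hQ.quasiMeasurePreserving k j).ae hp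

theorem Unbiased.eval_congr [IsFiniteMeasure P] (hQ : Q.Unbiased P) (k : ℕ)
    {E : Type*} [AddCommGroup E] [Module ℝ E] {f g : Ω → E} (h : f =ᵐ[P] g) :
    Q.eval k f =ᵐ[P'] Q.eval k g := by
  filter_upwards [hQ.ae_nodes k h] with ω' h'
  exact Finset.sum_congr rfl fun j _ => by rw [h' j]

theorem Unbiased.aestronglyMeasurable_eval [IsFiniteMeasure P] (hQ : Q.Unbiased P) (k : ℕ)
    {E : Type*} [NormedAddCommGroup E] [NormedSpace ℝ E] {f : Ω → E}
    (hf : AEStronglyMeasurable f P) : AEStronglyMeasurable (Q.eval k f) P' := by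
  unfold eval
  refine Finset.aestronglyMeasurable_fun_sum _ fun j _ => ?_
  exact (Q.ζ_meas k j).aestronglyMeasurable.smul
    (hf.comp_quasiMeasurePreserving (hQ.quasiMeasurePreserving k j))

/-- By Jensen's inequality, an unbiased formula with positive weights of sum one is a contraction
from `L^s(Ω)` to `L^s(Ω')`. -/
theorem Unbiased.eLpNorm_eval_le [IsFiniteMeasure P] (hQ : Q.Unbiased P) (k : ℕ) {s : ℝ}
    (hs : 1 ≤ s) {f : Ω → ℝ} (hf : MemLp f (ENNReal.ofReal s) P) (h0 : ∀ ω, 0 ≤ f ω) :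
    eLpNorm (Q.eval k f) (ENNReal.ofReal s) P' ≤ eLpNorm f (ENNReal.ofReal s) P := by
  have hs0 : 0 < s := by linarith
  have hp0 : ENNReal.ofReal s ≠ 0 := by simpa using hs0
  have hpt : ENNReal.ofReal s ≠ ⊤ := ENNReal.ofReal_ne_top
  have hr : (ENNReal.ofReal s).toReal = s := ENNReal.toReal_ofReal hs0.le
  have hfi := hf.integrable_norm_rpow hp0 hpt
  rw [hr] at hfi
  obtain ⟨hi, he⟩ := hQ k _ hfi
  have hle : ∀ᵐ ω' ∂P', ‖Q.eval k f ω'‖ ^ s ≤ Q.eval k (fun ω => ‖f ω‖ ^ s) ω' := by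
    filter_upwards [ae_all_iff.2 (Q.ζ_pos k), Q.ζ_sum k] with ω' h1 h2
    have h3 : 0 ≤ Q.eval k f ω' := Finset.sum_nonneg fun j _ => mul_nonneg (h1 j).le (h0 _)
    rw [Real.norm_of_nonneg h3]
    simp only [Real.norm_of_nonneg (h0 _)]
    exact Real.rpow_arith_mean_le_arith_mean_rpow _ _ _ (fun j _ => (h1 j).le) h2
      (fun j _ => h0 _) hs
  have hm := hQ.aestronglyMeasurable_eval k hf.aestronglyMeasurable
  have hie : Integrable (fun ω' => ‖Q.eval k f ω'‖ ^ s) P' := by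
    refine hi.mono' ?_ (hle.mono fun ω' h => ?_)
    · exact (hm.norm.aemeasurable.pow_const s).aestronglyMeasurable
    · rwa [Real.norm_of_nonneg (by positivity)]
  have hQf : MemLp (Q.eval k f) (ENNReal.ofReal s) P' :=
    (integrable_norm_rpow_iff hm hp0 hpt).1 (by rwa [hr])
  rw [hQf.eLpNorm_eq_integral_rpow_norm hp0 hpt, hf.eLpNorm_eq_integral_rpow_norm hp0 hpt, hr]
  refine ENNReal.ofReal_le_ofReal (Real.rpow_le_rpow (integral_nonneg fun _ => by positivity) ?_
    (by positivity))
  rw [← he]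
  exact integral_mono_ae hie hi hle

end RandomQuadrature

/-! ### Measurability of solutions of random linear equations -/

section Measurability

variable {Ω' : Type*} [MeasurableSpace Ω'] {P' : Measure Ω'}
  {U : Type*} [NormedAddCommGroup U] [InnerProductSpace ℝ U]

/-- A strongly measurable family of operators maps strongly measurable functions to strongly
measurable functions; the space need not be separable. -/
theorem aestronglyMeasurable_clm_apply {F : Ω' → U →L[ℝ] U}
    (hF : ∀ u, AEStronglyMeasurable (fun ω' => F ω' u) P') {w : Ω' → U}
    (hw : AEStronglyMeasurable w P') : AEStronglyMeasurable (fun ω' => F ω' (w ω')) P' := by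
  obtain ⟨w', hw', hww'⟩ := hw
  refine AEStronglyMeasurable.congr (f := fun ω' => F ω' (w' ω')) ?_
    (hww'.mono fun ω' h => by simp only [h])
  refine aestronglyMeasurable_of_tendsto_ae atTop (f := fun n ω' => F ω' (hw'.approx n ω'))
    (fun n => ?_) (Eventually.of_forall fun ω' =>
      ((F ω').continuous.tendsto _).comp (hw'.tendsto_approx ω'))
  have h : (fun ω' => F ω' (hw'.approx n ω')) = fun ω' => ∑ y ∈ (hw'.approx n).range,
      (hw'.approx n ⁻¹' {y}).indicator (fun ω' => F ω' y) ω' := by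
    funext ω'
    rw [Finset.sum_eq_single (hw'.approx n ω')]
    · rw [Set.indicator_of_mem (by simp)]
    · intro y _ hy
      exact Set.indicator_of_notMem (fun h => hy h.symm) _
    · intro h
      exact absurd (SimpleFunc.mem_range_self _ _) h
  rw [h]
  exact Finset.aestronglyMeasurable_fun_sum _ fun y _ =>
    (hF y).indicator ((hw'.approx n).measurableSet_fiber y)

/-- The Richardson iteration `x ↦ x - τ (ν x + G x - g)`, started at `0`, for the equation
`ν x + G x = g`. -/
def richardson (ν : ℝ) (G : U →L[ℝ] U) (g : U) (τ : ℝ) : ℕ → U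
  | 0 => 0
  | n + 1 => richardson ν G g τ n
      - τ • (ν • richardson ν G g τ n + G (richardson ν G g τ n) - g)

/-- For the step size `ν / (ν + R) ^ 2` the iteration is a contraction with factor
`√(1 - ν ^ 2 / (ν + R) ^ 2)`, as in the proof of the Lax-Milgram theorem. -/
theorem tendsto_richardson {ν R : ℝ} (hν : 0 < ν) {G : U →L[ℝ] U}
    (hG : ∀ u, 0 ≤ inner ℝ (G u) u) (hR : ‖G‖ ≤ R) {g e : U} (he : ν • e + G e = g) :
    Tendsto (richardson ν G g (ν / (ν + R) ^ 2)) atTop (𝓝 e) := by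
  have hR0 : 0 ≤ R := (norm_nonneg _).trans hR
  set τ := ν / (ν + R) ^ 2 with hτ
  set q := 1 - ν ^ 2 / (ν + R) ^ 2 with hq
  have hq0 : 0 ≤ q := by
    rw [hq, sub_nonneg]
    exact div_le_one_of_le₀ (pow_le_pow_left₀ hν.le (by linarith) 2) (by positivity)
  have hq1 : q < 1 := by
    have : 0 < ν ^ 2 / (ν + R) ^ 2 := by positivity
    linarith
  have hstep : ∀ x : U, ‖x - τ • (ν • x + G x)‖ ^ 2 ≤ q * ‖x‖ ^ 2 := by
    intro x
    have h1 : ν * ‖x‖ ^ 2 ≤ inner ℝ x (ν • x + G x) := by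
      rw [inner_add_right, real_inner_smul_right, real_inner_self_eq_norm_sq,
        real_inner_comm]
      linarith [hG x]
    have h2 : ‖ν • x + G x‖ ≤ (ν + R) * ‖x‖ := by
      refine (norm_add_le _ _).trans ?_
      rw [norm_smul, Real.norm_of_nonneg hν.le, add_mul]
      gcongr
      exact (G.le_opNorm x).trans (by gcongr)
    have h3 : ‖ν • x + G x‖ ^ 2 ≤ (ν + R) ^ 2 * ‖x‖ ^ 2 := by
      rw [← mul_pow]; gcongr
    have hτ0 : 0 ≤ τ := by positivity
    have h4 : τ ^ 2 * ((ν + R) ^ 2 * ‖x‖ ^ 2) = τ * ν * ‖x‖ ^ 2 := by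
      rw [hτ]; field_simp
    have h5 : q = 1 - τ * ν := by rw [hq, hτ]; ring
    rw [norm_sub_sq_real, real_inner_smul_right, norm_smul, mul_pow, Real.norm_eq_abs, sq_abs,
      h5]
    nlinarith [mul_le_mul_of_nonneg_left h1 hτ0, mul_le_mul_of_nonneg_left h3 (sq_nonneg τ)]
  have herr : ∀ n, ‖richardson ν G g τ n - e‖ ^ 2 ≤ q ^ n * ‖e‖ ^ 2 := by
    intro n
    induction n with
    | zero => simp [richardson]
    | succ n ih =>
      have h : richardson ν G g τ (n + 1) - e = (richardson ν G g τ n - e)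
          - τ • (ν • (richardson ν G g τ n - e) + G (richardson ν G g τ n - e)) := by
        rw [richardson, ← he, map_sub, smul_sub]
        module
      rw [h, pow_succ' q n, mul_assoc]
      exact (hstep _).trans (mul_le_mul_of_nonneg_left ih hq0)
  rw [tendsto_iff_norm_sub_tendsto_zero]
  have h1 : Tendsto (fun n => q ^ n * ‖e‖ ^ 2) atTop (𝓝 0) := by
    simpa using (tendsto_pow_atTop_nhds_zero_of_lt_one hq0 hq1).mul_const (‖e‖ ^ 2)
  have h2 := (squeeze_zero (fun n => by positivity) herr h1).sqrt
  simpa using h2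

/-- The solution of a regularized random linear equation is measurable, being the limit of the
Richardson iteration. -/
theorem aestronglyMeasurable_of_regularized {ν : ℝ} (hν : 0 < ν) {G : Ω' → U →L[ℝ] U}
    {g e : Ω' → U} {R : Ω' → ℝ} (hGm : ∀ u, AEStronglyMeasurable (fun ω' => G ω' u) P')
    (hgm : AEStronglyMeasurable g P') (hRm : AEStronglyMeasurable R P')
    (hG : ∀ᵐ ω' ∂P', ∀ u, 0 ≤ inner ℝ (G ω' u) u) (hR : ∀ᵐ ω' ∂P', ‖G ω'‖ ≤ R ω')
    (he : ∀ᵐ ω' ∂P', ν • e ω' + G ω' (e ω') = g ω') : AEStronglyMeasurable e P' := by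
  refine aestronglyMeasurable_of_tendsto_ae atTop
    (f := fun n ω' => richardson ν (G ω') (g ω') (ν / (ν + R ω') ^ 2) n) (fun n => ?_) ?_
  · have hτ : AEStronglyMeasurable (fun ω' => ν / (ν + R ω') ^ 2) P' :=
      (aemeasurable_const.div ((hRm.aemeasurable.const_add ν).pow_const 2)).aestronglyMeasurable
    induction n with
    | zero => exact aestronglyMeasurable_const
    | succ n ih =>
      exact ih.sub (hτ.smul (((ih.const_smul ν).add
        (aestronglyMeasurable_clm_apply hGm ih)).sub hgm))
  · filter_upwards [hG, hR, he] with ω' h1 h2 h3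
    exact tendsto_richardson hν h1 h2 h3

end Measurability

/-! ### The reduced problem -/

open ContinuousLinearMap in
theorem norm_adjoint_comp_self_sub_le {U H : Type*}
    [NormedAddCommGroup U] [InnerProductSpace ℝ U] [CompleteSpace U]
    [NormedAddCommGroup H] [InnerProductSpace ℝ H] [CompleteSpace H]
    {S T : U →L[ℝ] H} {d δ : ℝ} (hS : ‖S‖ ≤ d) (hT : ‖T‖ ≤ d) (hST : ‖S - T‖ ≤ δ * d) :
    ‖(adjoint S).comp S - (adjoint T).comp T‖ ≤ δ * (2 * d ^ 2) := by
  have h : (adjoint S).comp S - (adjoint T).comp T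
      = (adjoint S).comp (S - T) + (adjoint (S - T)).comp T := by
    ext u
    simp
  have hd : 0 ≤ d := (norm_nonneg _).trans hS
  have h0 : 0 ≤ δ * d := (norm_nonneg _).trans hST
  rw [h]
  calc _ ≤ ‖(adjoint S).comp (S - T)‖ + ‖(adjoint (S - T)).comp T‖ := norm_add_le _ _
    _ ≤ ‖adjoint S‖ * ‖S - T‖ + ‖adjoint (S - T)‖ * ‖T‖ :=
        add_le_add (opNorm_comp_le _ _) (opNorm_comp_le _ _)
    _ = ‖S‖ * ‖S - T‖ + ‖S - T‖ * ‖T‖ := by simp only [LinearIsometryEquiv.norm_map]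
    _ ≤ d * (δ * d) + (δ * d) * d := by gcongr
    _ = _ := by ring

/-- The reduced form of the control problem on a trial space: a random control-to-observation
operator `T`, with random norm bound `D`, and the associated adjoint variables `p u`, which are
linked to it by `⟨B v, p(u)⟩ = ⟪y_d - T u, T v⟫`. -/
structure IsReduced {Ω : Type*} [MeasurableSpace Ω] (P : Measure Ω) {U H Z : Type*}
    [NormedAddCommGroup U] [InnerProductSpace ℝ U]
    [NormedAddCommGroup H] [InnerProductSpace ℝ H]
    [NormedAddCommGroup Z] [InnerProductSpace ℝ Z]
    (B : U →L[ℝ] Z →L[ℝ] ℝ) (yd : H) (T : Ω → U →L[ℝ] H) (p : U → Ω → Z) (D : Ω → ℝ) : Prop where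
  norm_le : ∀ᵐ ω ∂P, ‖T ω‖ ≤ D ω
  sq_integrable : Integrable (fun ω => D ω ^ 2) P
  integrable : ∀ u, Integrable (p u) P
  dual : ∀ᵐ ω ∂P, ∀ u v, B v (p u ω) = inner ℝ (yd - T ω u) (T ω v)

namespace IsReduced

variable {Ω : Type*} [MeasurableSpace Ω] {P : Measure Ω}
  {U H Z : Type*}
  [NormedAddCommGroup U] [InnerProductSpace ℝ U]
  [NormedAddCommGroup H] [InnerProductSpace ℝ H]
  [NormedAddCommGroup Z] [InnerProductSpace ℝ Z]
  {B : U →L[ℝ] Z →L[ℝ] ℝ} {yd : H} {T : Ω → U →L[ℝ] H} {p : U → Ω → Z} {D : Ω → ℝ}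

section

/-- Integrability of the adjoint variables alone makes the misfit measurable: no measurability of
the solution operator enters. -/
theorem integrable_inner (h : IsReduced P B yd T p D) (u v : U) :
    Integrable (fun ω => inner ℝ (T ω u) (T ω v)) P := by
  refine (((B v).integrable_comp (h.integrable 0)).sub
    ((B v).integrable_comp (h.integrable u))).congr ?_
  filter_upwards [h.dual] with ω hω
  simp [hω, inner_sub_left]

theorem integrable_inner_target (h : IsReduced P B yd T p D) (v : U) :
    Integrable (fun ω => inner ℝ yd (T ω v)) P := by
  refine ((B v).integrable_comp (h.integrable 0)).congr ?_
  filter_upwards [h.dual] with ω hω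
  simp [hω]

variable [CompleteSpace U] [CompleteSpace Z]

theorem inner_rieszAdjoint_integral (h : IsReduced P B yd T p D) (u v : U) :
    inner ℝ (rieszAdjoint B (∫ ω, p u ω ∂P)) v
      = (∫ ω, inner ℝ yd (T ω v) ∂P) - ∫ ω, inner ℝ (T ω u) (T ω v) ∂P := by
  rw [inner_rieszAdjoint, ← (B v).integral_comp_comm (h.integrable u),
    ← integral_sub (h.integrable_inner_target v) (h.integrable_inner u v)]
  refine integral_congr_ae ?_
  filter_upwards [h.dual] with ω hω
  rw [hω, inner_sub_left]

/-- The mean `E[T^⋆ T]`, defined weakly: `ω ↦ T(ω)^⋆ T(ω)` need not be integrable in the operator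
norm. -/
theorem exists_meanGram (h : IsReduced P B yd T p D) :
    ∃ G : U →L[ℝ] U, ∀ u v, inner ℝ (G u) v = ∫ ω, inner ℝ (T ω u) (T ω v) ∂P := by
  have key : ∀ u v, inner ℝ (rieszAdjoint B (∫ ω, p 0 ω ∂P) - rieszAdjoint B (∫ ω, p u ω ∂P)) v
      = ∫ ω, inner ℝ (T ω u) (T ω v) ∂P := by
    intro u v
    rw [inner_sub_left, h.inner_rieszAdjoint_integral, h.inner_rieszAdjoint_integral]
    simp
  refine ⟨LinearMap.mkContinuous
    { toFun := fun u => rieszAdjoint B (∫ ω, p 0 ω ∂P) - rieszAdjoint B (∫ ω, p u ω ∂P)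
      map_add' := fun u v => ext_inner_right ℝ fun w => ?_
      map_smul' := fun t u => ext_inner_right ℝ fun w => ?_ } (∫ ω, D ω ^ 2 ∂P) fun u => ?_, key⟩
  · rw [key, inner_add_left, key, key,
      ← integral_add (h.integrable_inner u w) (h.integrable_inner v w)]
    simp [inner_add_left]
  · rw [RingHom.id_apply, key, inner_smul_left, key, ← integral_const_mul]
    simp [inner_smul_left]
  · change ‖rieszAdjoint B (∫ ω, p 0 ω ∂P) - rieszAdjoint B (∫ ω, p u ω ∂P)‖ ≤ _
    set x := rieszAdjoint B (∫ ω, p 0 ω ∂P) - rieszAdjoint B (∫ ω, p u ω ∂P) with hx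
    have h1 : ‖x‖ * ‖x‖ ≤ (∫ ω, D ω ^ 2 ∂P) * ‖u‖ * ‖x‖ := by
      rw [← real_inner_self_eq_norm_mul_norm, hx, key, ← hx, mul_assoc, ← integral_mul_const]
      refine integral_mono_ae (h.integrable_inner u x) (h.sq_integrable.mul_const _) ?_
      filter_upwards [h.norm_le] with ω hω
      have hD : 0 ≤ D ω := (norm_nonneg _).trans hω
      calc inner ℝ (T ω u) (T ω x) ≤ ‖T ω u‖ * ‖T ω x‖ := real_inner_le_norm _ _
        _ ≤ (D ω * ‖u‖) * (D ω * ‖x‖) := by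
            gcongr
            · exact (T ω).le_of_opNorm_le hω u
            · exact (T ω).le_of_opNorm_le hω x
        _ = _ := by ring
    rcases (norm_nonneg x).eq_or_lt with h0 | h0
    · rw [← h0]
      exact mul_nonneg (integral_nonneg fun _ => sq_nonneg _) (norm_nonneg _)
    · exact le_of_mul_le_mul_right h1 h0

/-- The optimality condition `ν u = Λ_U⁻¹ B^⋆ E[p(u)]`. -/
theorem smul_minimizer [IsProbabilityMeasure P] (h : IsReduced P B yd T p D) {ν : ℝ} (hν : 0 < ν)
    {J : U → ℝ}
    (hJ : ∀ u, J u = 1 / 2 * (∫ ω, ‖T ω u - yd‖ ^ 2 ∂P) + ν / 2 * ‖u‖ ^ 2) :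
    ν • minimizer J = rieszAdjoint B (∫ ω, p (minimizer J) ω ∂P) := by
  obtain ⟨G, hG⟩ := h.exists_meanGram
  have h1 := minimizer_spec (J := J) (G := G) (g := rieszAdjoint B (∫ ω, p 0 ω ∂P))
    (c := 1 / 2 * ‖yd‖ ^ 2) hν
    (fun u v => by rw [hG, real_inner_comm, hG]; simp only [real_inner_comm])
    (fun u => by rw [hG]; exact integral_nonneg fun ω => real_inner_self_nonneg)
    (fun u => by
      rw [hJ, h.inner_rieszAdjoint_integral, hG]
      have e : ∫ ω, ‖T ω u - yd‖ ^ 2 ∂P = (∫ ω, inner ℝ (T ω u) (T ω u) ∂P)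
          - 2 * (∫ ω, inner ℝ yd (T ω u) ∂P) + ‖yd‖ ^ 2 := by
        rw [← integral_const_mul, ← integral_sub (h.integrable_inner u u)
          ((h.integrable_inner_target u).const_mul 2)]
        have : ‖yd‖ ^ 2 = ∫ _, ‖yd‖ ^ 2 ∂P := by simp
        have hi : Integrable (fun ω => inner ℝ (T ω u) (T ω u) - 2 * inner ℝ yd (T ω u)) P :=
          (h.integrable_inner u u).sub ((h.integrable_inner_target u).const_mul 2)
        rw [this, ← integral_add hi (integrable_const _)]
        refine integral_congr_ae (Eventually.of_forall fun ω => ?_)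
        simp only
        rw [norm_sub_sq_real, real_inner_self_eq_norm_sq, real_inner_comm]
      rw [e]
      simp
      ring)
  rw [eq_sub_of_add_eq h1]
  refine ext_inner_right ℝ fun v => ?_
  rw [inner_sub_left, hG, h.inner_rieszAdjoint_integral, h.inner_rieszAdjoint_integral]
  simp

/-- The optimal control depends Lipschitz continuously on the control-to-observation operator. -/
theorem norm_minimizer_sub_le [IsProbabilityMeasure P] {T' : Ω → U →L[ℝ] H} {p' : U → Ω → Z}
    (h : IsReduced P B yd T p D) (h' : IsReduced P B yd T' p' D) (hD : Integrable D P)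
    {δ : ℝ} (hδ : 0 ≤ δ) (hTT : ∀ᵐ ω ∂P, ‖T ω - T' ω‖ ≤ δ * D ω)
    {ν : ℝ} (hν : 0 < ν) {J J' : U → ℝ}
    (hJ : ∀ u, J u = 1 / 2 * (∫ ω, ‖T ω u - yd‖ ^ 2 ∂P) + ν / 2 * ‖u‖ ^ 2)
    (hJ' : ∀ u, J' u = 1 / 2 * (∫ ω, ‖T' ω u - yd‖ ^ 2 ∂P) + ν / 2 * ‖u‖ ^ 2) :
    ‖minimizer J' - minimizer J‖ ≤ δ * (ν⁻¹ *
      (‖yd‖ * (∫ ω, D ω ∂P) + 2 * (∫ ω, D ω ^ 2 ∂P) * ‖minimizer J‖)) := by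
  obtain ⟨G', hG'⟩ := h'.exists_meanGram
  have hm := h.smul_minimizer hν hJ
  have hm' := h'.smul_minimizer hν hJ'
  set u := minimizer J
  set u' := minimizer J'
  -- The residual of the first control in the normal equation of the second one.
  set r := rieszAdjoint B (∫ ω, p' u ω ∂P) - rieszAdjoint B (∫ ω, p u ω ∂P) with hr
  have heq : ν • (u' - u) + G' (u' - u) = r := by
    refine ext_inner_right ℝ fun v => ?_
    rw [smul_sub, hm, hm', hr, inner_add_left, hG', inner_sub_left, inner_sub_left,
      h'.inner_rieszAdjoint_integral, h'.inner_rieszAdjoint_integral]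
    have : ∫ ω, inner ℝ (T' ω (u' - u)) (T' ω v) ∂P = (∫ ω, inner ℝ (T' ω u') (T' ω v) ∂P)
        - ∫ ω, inner ℝ (T' ω u) (T' ω v) ∂P := by
      rw [← integral_sub (h'.integrable_inner u' v) (h'.integrable_inner u v)]
      simp [inner_sub_left]
    rw [this]
    ring
  have hG'0 : ∀ w, 0 ≤ inner ℝ (G' w) w := fun w => by
    rw [hG']; exact integral_nonneg fun ω => real_inner_self_nonneg
  have h1 := norm_le_of_regularized hG'0 heq
  set M := ‖yd‖ * (∫ ω, D ω ∂P) + 2 * (∫ ω, D ω ^ 2 ∂P) * ‖u‖ with hM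
  have hD0 : ∀ᵐ ω ∂P, 0 ≤ D ω := h.norm_le.mono fun ω hω => (norm_nonneg _).trans hω
  have hM0 : 0 ≤ M := by
    have h2 : 0 ≤ ∫ ω, D ω ∂P := integral_nonneg_of_ae hD0
    have h3 : 0 ≤ ∫ ω, D ω ^ 2 ∂P := integral_nonneg fun _ => sq_nonneg _
    positivity
  have h2 : ‖r‖ * ‖r‖ ≤ (δ * M) * ‖r‖ := by
    rw [← real_inner_self_eq_norm_mul_norm]
    have e1 : inner ℝ r r = ∫ ω, ((inner ℝ yd (T' ω r) - inner ℝ (T' ω u) (T' ω r))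
        - (inner ℝ yd (T ω r) - inner ℝ (T ω u) (T ω r))) ∂P := by
      nth_rewrite 1 [hr]
      rw [inner_sub_left, h.inner_rieszAdjoint_integral, h'.inner_rieszAdjoint_integral,
        ← integral_sub (h.integrable_inner_target r) (h.integrable_inner u r),
        ← integral_sub (h'.integrable_inner_target r) (h'.integrable_inner u r)]
      exact (integral_sub ((h'.integrable_inner_target r).sub (h'.integrable_inner u r))
        ((h.integrable_inner_target r).sub (h.integrable_inner u r))).symm
    have e2 : (δ * M) * ‖r‖ = ∫ ω, (δ * (‖yd‖ * D ω + 2 * D ω ^ 2 * ‖u‖)) * ‖r‖ ∂P := by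
      rw [integral_mul_const, integral_const_mul, integral_add (hD.const_mul _)
        ((h.sq_integrable.const_mul 2).mul_const _), integral_const_mul, integral_mul_const,
        integral_const_mul]
    rw [e1, e2]
    refine integral_mono_ae (((h'.integrable_inner_target r).sub (h'.integrable_inner u r)).sub
      ((h.integrable_inner_target r).sub (h.integrable_inner u r)))
      ((((hD.const_mul _).add ((h.sq_integrable.const_mul 2).mul_const _)).const_mul δ).mul_const _)
      ?_
    filter_upwards [h.norm_le, h'.norm_le, hTT, hD0] with ω hω hω' hd hD0
    have e3 : (inner ℝ yd (T' ω r) - inner ℝ (T' ω u) (T' ω r))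
        - (inner ℝ yd (T ω r) - inner ℝ (T ω u) (T ω r))
        = -inner ℝ yd ((T ω - T' ω) r) + inner ℝ (T ω u) ((T ω - T' ω) r)
          + inner ℝ ((T ω - T' ω) u) (T' ω r) := by
      simp only [sub_apply, inner_sub_left, inner_sub_right]; ring
    have b1 : ‖(T ω - T' ω) r‖ ≤ δ * D ω * ‖r‖ := (T ω - T' ω).le_of_opNorm_le hd r
    have b2 : ‖(T ω - T' ω) u‖ ≤ δ * D ω * ‖u‖ := (T ω - T' ω).le_of_opNorm_le hd u
    have b3 : ‖T' ω r‖ ≤ D ω * ‖r‖ := (T' ω).le_of_opNorm_le hω' r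
    have b4 : ‖T ω u‖ ≤ D ω * ‖u‖ := (T ω).le_of_opNorm_le hω u
    change (inner ℝ yd (T' ω r) - inner ℝ (T' ω u) (T' ω r))
        - (inner ℝ yd (T ω r) - inner ℝ (T ω u) (T ω r)) ≤ _
    rw [e3]
    have c1 : -inner ℝ yd ((T ω - T' ω) r) ≤ ‖yd‖ * (δ * D ω * ‖r‖) :=
      (neg_le_abs _).trans ((abs_real_inner_le_norm _ _).trans (by gcongr))
    have c2 : inner ℝ (T ω u) ((T ω - T' ω) r) ≤ (D ω * ‖u‖) * (δ * D ω * ‖r‖) :=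
      (real_inner_le_norm _ _).trans (by gcongr)
    have c3 : inner ℝ ((T ω - T' ω) u) (T' ω r) ≤ (δ * D ω * ‖u‖) * (D ω * ‖r‖) :=
      (real_inner_le_norm _ _).trans (by gcongr)
    calc _ ≤ ‖yd‖ * (δ * D ω * ‖r‖) + (D ω * ‖u‖) * (δ * D ω * ‖r‖)
          + (δ * D ω * ‖u‖) * (D ω * ‖r‖) := by linarith
      _ = _ := by ring
  have h3 : ‖r‖ ≤ δ * M := by
    rcases (norm_nonneg r).eq_or_lt with h0 | h0
    · rw [← h0]; positivity
    · exact le_of_mul_le_mul_right h2 h0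
  calc ‖u' - u‖ ≤ ν⁻¹ * ‖r‖ := by
        rw [inv_mul_eq_div, le_div_iff₀ hν, mul_comm]; exact h1
    _ ≤ ν⁻¹ * (δ * M) := by gcongr
    _ = _ := by ring

end

end IsReduced

/-! ### Quadrature of the reduced problem -/

/-- The error `E f - Q^k[f]` of the `k`-th formula; it is random. -/
noncomputable def RandomQuadrature.error {Ω : Type*} [MeasurableSpace Ω] {Ω' : Type*}
    [MeasurableSpace Ω'] {P' : Measure Ω'} (Q : RandomQuadrature Ω P') (P : Measure Ω)
    {E : Type*} [NormedAddCommGroup E] [NormedSpace ℝ E] (k : ℕ) (f : Ω → E) (ω' : Ω') : E :=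
  (∫ ω, f ω ∂P) - Q.eval k f ω'

section Error

variable {Ω : Type*} [MeasurableSpace Ω] {P : Measure Ω}
  {Ω' : Type*} [MeasurableSpace Ω'] {P' : Measure Ω'} {Q : RandomQuadrature Ω P'}
  {E : Type*} [NormedAddCommGroup E] [NormedSpace ℝ E]

theorem RandomQuadrature.Unbiased.aestronglyMeasurable_error [IsFiniteMeasure P]
    [IsFiniteMeasure P'] (hQ : Q.Unbiased P) (k : ℕ) {f : Ω → E} (hf : AEStronglyMeasurable f P) :
    AEStronglyMeasurable (Q.error P k f) P' :=
  aestronglyMeasurable_const.sub (hQ.aestronglyMeasurable_eval k hf)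

theorem RandomQuadrature.Unbiased.error_congr [IsFiniteMeasure P] (hQ : Q.Unbiased P) (k : ℕ)
    {f g : Ω → E} (h : f =ᵐ[P] g) : Q.error P k f =ᵐ[P'] Q.error P k g := by
  filter_upwards [hQ.eval_congr k h] with ω' h'
  rw [error, error, h', integral_congr_ae h]

theorem RandomQuadrature.error_sub (Q : RandomQuadrature Ω P') (k : ℕ) {f g : Ω → E}
    (hf : Integrable f P) (hg : Integrable g P) (ω' : Ω') :
    Q.error P k (f - g) ω' = Q.error P k f ω' - Q.error P k g ω' := by
  simp only [error, eval, Pi.sub_apply, integral_sub hf hg, smul_sub, Finset.sum_sub_distrib]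
  abel

end Error

section Gram

variable {Ω : Type*} [MeasurableSpace Ω] {Ω' : Type*} [MeasurableSpace Ω'] {P' : Measure Ω'}
  {U H : Type*}
  [NormedAddCommGroup U] [InnerProductSpace ℝ U] [CompleteSpace U]
  [NormedAddCommGroup H] [InnerProductSpace ℝ H] [CompleteSpace H]

/-- The quadrature approximation `Q^k[T^⋆ T]` of the mean of `T^⋆ T`. -/
noncomputable def RandomQuadrature.gram (Q : RandomQuadrature Ω P') (k : ℕ) (T : Ω → U →L[ℝ] H)
    (ω' : Ω') : U →L[ℝ] U :=
  Q.eval k (fun ω => (ContinuousLinearMap.adjoint (T ω)).comp (T ω)) ω'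

variable (Q : RandomQuadrature Ω P') (k : ℕ) (T : Ω → U →L[ℝ] H)

theorem RandomQuadrature.inner_gram (ω' : Ω') (u v : U) :
    inner ℝ (Q.gram k T ω' u) v = Q.eval k (fun ω => inner ℝ (T ω u) (T ω v)) ω' := by
  simp [gram, eval, sum_inner, inner_smul_left, ContinuousLinearMap.adjoint_inner_left]

theorem RandomQuadrature.inner_gram_comm (ω' : Ω') (u v : U) :
    inner ℝ (Q.gram k T ω' u) v = inner ℝ u (Q.gram k T ω' v) := by
  rw [inner_gram, real_inner_comm, inner_gram]
  simp only [real_inner_comm]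

theorem RandomQuadrature.ae_inner_gram_nonneg :
    ∀ᵐ ω' ∂P', ∀ T : Ω → U →L[ℝ] H, ∀ u, 0 ≤ inner ℝ (Q.gram k T ω' u) u := by
  filter_upwards [ae_all_iff.2 (Q.ζ_pos k)] with ω' h T u
  rw [inner_gram]
  exact Finset.sum_nonneg fun j _ => mul_nonneg (h j).le real_inner_self_nonneg

variable {P : Measure Ω} [IsFiniteMeasure P] {Q T}

theorem RandomQuadrature.Unbiased.norm_gram_sub_le (hQ : Q.Unbiased P) {T' : Ω → U →L[ℝ] H}
    {D : Ω → ℝ} {δ : ℝ} (hT : ∀ᵐ ω ∂P, ‖T ω‖ ≤ D ω) (hT' : ∀ᵐ ω ∂P, ‖T' ω‖ ≤ D ω)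
    (hTT : ∀ᵐ ω ∂P, ‖T ω - T' ω‖ ≤ δ * D ω) :
    ∀ᵐ ω' ∂P', ‖Q.gram k T ω' - Q.gram k T' ω'‖ ≤ δ * Q.eval k (fun ω => 2 * D ω ^ 2) ω' := by
  have h : ∀ᵐ ω ∂P, ‖(ContinuousLinearMap.adjoint (T ω)).comp (T ω)
      - (ContinuousLinearMap.adjoint (T' ω)).comp (T' ω)‖ ≤ δ * (2 * D ω ^ 2) := by
    filter_upwards [hT, hT', hTT] with ω h1 h2 h3
    exact norm_adjoint_comp_self_sub_le h1 h2 h3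
  filter_upwards [hQ.ae_nodes k h, ae_all_iff.2 (Q.ζ_pos k)] with ω' h1 h2
  simp only [gram, eval, ← Finset.sum_sub_distrib, ← smul_sub, Finset.mul_sum]
  refine (norm_sum_le _ _).trans (Finset.sum_le_sum fun j _ => ?_)
  rw [norm_smul, Real.norm_of_nonneg (h2 j).le, smul_eq_mul, mul_left_comm]
  exact mul_le_mul_of_nonneg_left (h1 j) (h2 j).le

theorem RandomQuadrature.Unbiased.norm_gram_le (hQ : Q.Unbiased P) {D : Ω → ℝ}
    (hT : ∀ᵐ ω ∂P, ‖T ω‖ ≤ D ω) :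
    ∀ᵐ ω' ∂P', ‖Q.gram k T ω'‖ ≤ Q.eval k (fun ω => 2 * D ω ^ 2) ω' := by
  have h0 : ∀ ω', Q.gram k (0 : Ω → U →L[ℝ] H) ω' = 0 := fun ω' => by simp [gram, eval]
  filter_upwards [hQ.norm_gram_sub_le k (T' := 0) (δ := 1) hT
    (hT.mono fun ω h => by simpa using (norm_nonneg _).trans h)
    (hT.mono fun ω h => by simpa using h)] with ω' h
  simpa [h0] using h

end Gram

namespace IsReduced

variable {Ω : Type*} [MeasurableSpace Ω] {P : Measure Ω} [IsProbabilityMeasure P]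
  {Ω' : Type*} [MeasurableSpace Ω'] {P' : Measure Ω'} {Q : RandomQuadrature Ω P'}
  {U H Z : Type*}
  [NormedAddCommGroup U] [InnerProductSpace ℝ U] [CompleteSpace U]
  [NormedAddCommGroup H] [InnerProductSpace ℝ H] [CompleteSpace H]
  [NormedAddCommGroup Z] [InnerProductSpace ℝ Z]
  {B : U →L[ℝ] Z →L[ℝ] ℝ} {yd : H} {T : Ω → U →L[ℝ] H} {p : U → Ω → Z} {D : Ω → ℝ}

/-- The gradient of the misfit at `u`, up to sign, is affine in `u` for almost every sample. -/
theorem ae_rieszAdjoint_eval (h : IsReduced P B yd T p D) (hQ : Q.Unbiased P) (k : ℕ) :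
    ∀ᵐ ω' ∂P', ∀ u, rieszAdjoint B (Q.eval k (p u) ω')
      = rieszAdjoint B (Q.eval k (p 0) ω') - Q.gram k T ω' u := by
  filter_upwards [hQ.ae_nodes k h.dual] with ω' h1 u
  refine ext_inner_right ℝ fun v => ?_
  rw [inner_sub_left, Q.inner_gram, inner_rieszAdjoint, inner_rieszAdjoint]
  simp [RandomQuadrature.eval, h1, inner_sub_left, mul_sub, Finset.sum_sub_distrib]

/-- The normal equation of the fully discretized problem. -/
theorem ae_minimizer_eval (h : IsReduced P B yd T p D) (hQ : Q.Unbiased P) (k : ℕ)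
    {ν : ℝ} (hν : 0 < ν) {J : Ω' → U → ℝ} (hJ : ∀ᵐ ω' ∂P', ∀ u,
      J ω' u = 1 / 2 * Q.eval k (fun ω => ‖T ω u - yd‖ ^ 2) ω' + ν / 2 * ‖u‖ ^ 2) :
    ∀ᵐ ω' ∂P', ν • minimizer (J ω') + Q.gram k T ω' (minimizer (J ω'))
      = rieszAdjoint B (Q.eval k (p 0) ω') := by
  filter_upwards [hQ.ae_nodes k h.dual, hJ, Q.ae_inner_gram_nonneg (U := U) (H := H) k]
    with ω' h1 hJ h2
  refine minimizer_spec (c := 1 / 2 * Q.eval k (fun _ => ‖yd‖ ^ 2) ω') hν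
    (Q.inner_gram_comm k T ω') (h2 T) fun u => ?_
  have e : Q.eval k (fun ω => ‖T ω u - yd‖ ^ 2) ω'
      = Q.eval k (fun ω => inner ℝ (T ω u) (T ω u)) ω'
        - 2 * inner ℝ (rieszAdjoint B (Q.eval k (p 0) ω')) u
        + Q.eval k (fun _ => ‖yd‖ ^ 2) ω' := by
    rw [inner_rieszAdjoint]
    simp only [RandomQuadrature.eval, map_sum, map_smul, h1, map_zero, sub_zero, Finset.mul_sum,
      ← Finset.sum_sub_distrib, ← Finset.sum_add_distrib, smul_eq_mul]
    refine Finset.sum_congr rfl fun j _ => ?_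
    rw [norm_sub_sq_real, real_inner_self_eq_norm_sq, real_inner_comm]
    ring
  rw [hJ, Q.inner_gram, e]
  ring

theorem ae_smul_minimizer_eval (h : IsReduced P B yd T p D) (hQ : Q.Unbiased P) (k : ℕ)
    {ν : ℝ} (hν : 0 < ν) {J : Ω' → U → ℝ} (hJ : ∀ᵐ ω' ∂P', ∀ u,
      J ω' u = 1 / 2 * Q.eval k (fun ω => ‖T ω u - yd‖ ^ 2) ω' + ν / 2 * ‖u‖ ^ 2) :
    ∀ᵐ ω' ∂P', ν • minimizer (J ω')
      = rieszAdjoint B (Q.eval k (p (minimizer (J ω'))) ω') := by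
  filter_upwards [h.ae_minimizer_eval hQ k hν hJ, h.ae_rieszAdjoint_eval hQ k] with ω' h1 h2
  rw [h2, ← h1, add_sub_cancel_right]

theorem aestronglyMeasurable_minimizer (h : IsReduced P B yd T p D) (hQ : Q.Unbiased P) (k : ℕ)
    {ν : ℝ} (hν : 0 < ν) {J : Ω' → U → ℝ} (hJ : ∀ᵐ ω' ∂P', ∀ u,
      J ω' u = 1 / 2 * Q.eval k (fun ω => ‖T ω u - yd‖ ^ 2) ω' + ν / 2 * ‖u‖ ^ 2) :
    AEStronglyMeasurable (fun ω' => minimizer (J ω')) P' := by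
  have hm : ∀ u, AEStronglyMeasurable (fun ω' => rieszAdjoint B (Q.eval k (p u) ω')) P' := fun u =>
    (rieszAdjoint B).continuous.comp_aestronglyMeasurable
      (hQ.aestronglyMeasurable_eval k (h.integrable u).aestronglyMeasurable)
  refine aestronglyMeasurable_of_regularized hν (fun u => ?_) (hm 0)
    (hQ.aestronglyMeasurable_eval k (h.sq_integrable.const_mul 2).aestronglyMeasurable)
    ((Q.ae_inner_gram_nonneg k).mono fun ω' h => h T) (hQ.norm_gram_le k h.norm_le)
    (h.ae_minimizer_eval hQ k hν hJ)
  refine ((hm 0).sub (hm u)).congr ?_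
  filter_upwards [h.ae_rieszAdjoint_eval hQ k] with ω' h1
  rw [Pi.sub_apply, h1 u, sub_sub_cancel]

variable [CompleteSpace Z]

/-- The error of the optimal control caused by the quadrature solves a regularized equation whose
right-hand side is the quadrature error of the adjoint variable at the exact control. -/
theorem ae_quadrature_error (h : IsReduced P B yd T p D) (hQ : Q.Unbiased P) (k : ℕ)
    {ν : ℝ} (hν : 0 < ν) {J : U → ℝ} {Jk : Ω' → U → ℝ}
    (hJ : ∀ u, J u = 1 / 2 * (∫ ω, ‖T ω u - yd‖ ^ 2 ∂P) + ν / 2 * ‖u‖ ^ 2)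
    (hJk : ∀ᵐ ω' ∂P', ∀ u,
      Jk ω' u = 1 / 2 * Q.eval k (fun ω => ‖T ω u - yd‖ ^ 2) ω' + ν / 2 * ‖u‖ ^ 2) :
    ∀ᵐ ω' ∂P', ν • (minimizer J - minimizer (Jk ω'))
        + Q.gram k T ω' (minimizer J - minimizer (Jk ω'))
      = rieszAdjoint B (Q.error P k (p (minimizer J)) ω') := by
  filter_upwards [h.ae_minimizer_eval hQ k hν hJk, h.ae_rieszAdjoint_eval hQ k] with ω' h1 h2
  rw [RandomQuadrature.error, map_sub (rieszAdjoint B), h2, ← h1, ← h.smul_minimizer hν hJ, map_sub, smul_sub]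
  abel

/-- The difference between two levels of the quadrature error of the optimal control. The first
term on the right is the quadrature error of the difference of the adjoint variables, the second
one the product of the distance of the levels and the quadrature error of one level. -/
theorem ae_norm_quadrature_error_sub_le (h : IsReduced P B yd T p D) {T' : Ω → U →L[ℝ] H}
    {p' : U → Ω → Z} (h' : IsReduced P B yd T' p' D) (hQ : Q.Unbiased P) (k : ℕ)
    {δ : ℝ} (hTT : ∀ᵐ ω ∂P, ‖T ω - T' ω‖ ≤ δ * D ω)
    {ν : ℝ} (hν : 0 < ν) {J J' : U → ℝ} {Jk Jk' : Ω' → U → ℝ}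
    (hJ : ∀ u, J u = 1 / 2 * (∫ ω, ‖T ω u - yd‖ ^ 2 ∂P) + ν / 2 * ‖u‖ ^ 2)
    (hJ' : ∀ u, J' u = 1 / 2 * (∫ ω, ‖T' ω u - yd‖ ^ 2 ∂P) + ν / 2 * ‖u‖ ^ 2)
    (hJk : ∀ᵐ ω' ∂P', ∀ u,
      Jk ω' u = 1 / 2 * Q.eval k (fun ω => ‖T ω u - yd‖ ^ 2) ω' + ν / 2 * ‖u‖ ^ 2)
    (hJk' : ∀ᵐ ω' ∂P', ∀ u,
      Jk' ω' u = 1 / 2 * Q.eval k (fun ω => ‖T' ω u - yd‖ ^ 2) ω' + ν / 2 * ‖u‖ ^ 2) :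
    ∀ᵐ ω' ∂P', ‖(minimizer J - minimizer (Jk ω')) - (minimizer J' - minimizer (Jk' ω'))‖
      ≤ (ν⁻¹ * ‖rieszAdjoint B‖)
          * ‖Q.error P k (p (minimizer J)) ω' - Q.error P k (p' (minimizer J')) ω'‖
        + (ν⁻¹ ^ 2 * ‖rieszAdjoint B‖ * δ)
          * ‖Q.eval k (fun ω => 2 * D ω ^ 2) ω' • Q.error P k (p' (minimizer J')) ω'‖ := by
  filter_upwards [h.ae_quadrature_error hQ k hν hJ hJk, h'.ae_quadrature_error hQ k hν hJ' hJk',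
    Q.ae_inner_gram_nonneg (U := U) (H := H) k, hQ.norm_gram_sub_le k h.norm_le h'.norm_le hTT,
    ae_all_iff.2 (Q.ζ_pos k)] with ω' e e' hG hGG hζ
  have h1 := norm_sub_le_of_regularized (hG T) e e'
  have h2 := norm_le_of_regularized (hG T') e'
  rw [← map_sub] at h1
  set X := Q.error P k (p (minimizer J)) ω' - Q.error P k (p' (minimizer J')) ω'
  set Y := Q.error P k (p' (minimizer J')) ω'
  set M := Q.eval k (fun ω => 2 * D ω ^ 2) ω'
  set e₁ := minimizer J - minimizer (Jk ω')
  set e₂ := minimizer J' - minimizer (Jk' ω')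
  have h3 : ‖e₂‖ ≤ ν⁻¹ * (‖rieszAdjoint B‖ * ‖Y‖) := by
    rw [inv_mul_eq_div, le_div_iff₀ hν, mul_comm]
    exact h2.trans ((rieszAdjoint B).le_opNorm _)
  have hδM : 0 ≤ δ * M := (norm_nonneg _).trans hGG
  have h4 : ν * ‖e₁ - e₂‖ ≤ ‖rieszAdjoint B‖ * ‖X‖
      + δ * M * (ν⁻¹ * (‖rieszAdjoint B‖ * ‖Y‖)) :=
    h1.trans (add_le_add ((rieszAdjoint B).le_opNorm _) (mul_le_mul hGG h3 (norm_nonneg _) hδM))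
  calc ‖e₁ - e₂‖ ≤ ν⁻¹ * (‖rieszAdjoint B‖ * ‖X‖
      + δ * M * (ν⁻¹ * (‖rieszAdjoint B‖ * ‖Y‖))) := by
        rw [inv_mul_eq_div, le_div_iff₀ hν, mul_comm]; exact h4
    _ = (ν⁻¹ * ‖rieszAdjoint B‖) * ‖X‖
      + (ν⁻¹ ^ 2 * ‖rieszAdjoint B‖ * δ) * (M * ‖Y‖) := by ring
    _ ≤ _ := by
        have hM : M * ‖Y‖ = ‖M • Y‖ := by
          rw [norm_smul, Real.norm_of_nonneg]
          exact Finset.sum_nonneg fun j _ => mul_nonneg (hζ j).le (by positivity)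
        rw [hM]

end IsReduced

/-! ### Finite element spaces and mesh sizes -/

namespace FEFamily

variable {V : Type*} [NormedAddCommGroup V] [InnerProductSpace ℝ V] (fe : FEFamily V)

theorem exists_rpow_le {a b : ℝ} (hab : a ≤ b) :
    ∃ c : ℝ, 0 < c ∧ ∀ l, fe.h l ^ b ≤ c * fe.h l ^ a := by
  obtain ⟨m, hm⟩ := fe.h_bdd
  have hm' : ∀ l, fe.h l ≤ m := fun l => hm ⟨l, rfl⟩
  have hm0 : 0 < m := (fe.h_pos 0).trans_le (hm' 0)
  refine ⟨m ^ (b - a), Real.rpow_pos_of_pos hm0 _, fun l => ?_⟩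
  have h0 := fe.h_pos l
  calc fe.h l ^ b = fe.h l ^ (b - a) * fe.h l ^ a := by
        rw [← Real.rpow_add h0, sub_add_cancel]
    _ ≤ _ := by
        gcongr
        exact hm' l

theorem exists_rpow_le_rpow_succ {a : ℝ} (ha : 0 ≤ a) :
    ∃ c : ℝ, 0 < c ∧ ∀ l, fe.h l ^ a ≤ c * fe.h (l + 1) ^ a := by
  obtain ⟨τ, hτ⟩ := fe.ratio_bdd
  have hτ0 : 0 < τ := (div_pos (fe.h_pos 0) (fe.h_pos 1)).trans_le (hτ 0)
  refine ⟨τ ^ a, Real.rpow_pos_of_pos hτ0 _, fun l => ?_⟩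
  rw [← Real.mul_rpow hτ0.le (fe.h_pos _).le]
  exact Real.rpow_le_rpow (fe.h_pos l).le ((div_le_iff₀ (fe.h_pos _)).1 (hτ l)) ha

theorem completeSpace (l : ℕ) : CompleteSpace (fe.space l) :=
  have := fe.finDim l
  FiniteDimensional.complete ℝ _

end FEFamily

/-! ### Reduction of the control problem -/

namespace RandomOCP

variable {Ω : Type*} [MeasurableSpace Ω] {P : Measure Ω}
  {V U H Z W : Type*}
  [NormedAddCommGroup V] [InnerProductSpace ℝ V]
  [NormedAddCommGroup U] [InnerProductSpace ℝ U]
  [NormedAddCommGroup H] [InnerProductSpace ℝ H]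
  [NormedAddCommGroup Z] [InnerProductSpace ℝ Z]
  [NormedAddCommGroup W] [InnerProductSpace ℝ W]
  {prob : RandomOCP P V U H Z W} {fe : FEFamily V} {αW αZ : ℝ}

/-- The control-to-observation operators are bounded, and converge at the rate `α ≤ αW`, with a
random constant that has moments of all orders. -/
theorem exists_bound [CompleteSpace V] (hF : FEAssumption prob fe αW αZ) {α : ℝ} (hα : α ≤ αW) :
    ∃ D : Ω → ℝ, (∀ q : ℝ, 1 ≤ q → MemLp D (ENNReal.ofReal q) P) ∧
      ∀ᵐ ω ∂P, ‖prob.ctrlToObs ⊤ ω‖ ≤ D ω ∧ ∀ l, ‖prob.ctrlToObs (fe.space l) ω‖ ≤ D ω ∧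
        ‖prob.ctrlToObs ⊤ ω - prob.ctrlToObs (fe.space l) ω‖ ≤ fe.h l ^ α * D ω := by
  obtain ⟨Ca, hCa, hfw⟩ := hF.forward
  obtain ⟨c₀, hc₀, hc₀'⟩ := fe.exists_rpow_le (a := 0) hF.αW_pos.le
  obtain ⟨c₁, hc₁, hc₁'⟩ := fe.exists_rpow_le hα
  simp only [Real.rpow_zero, mul_one] at hc₀'
  set κ := ‖prob.obs‖ * (‖prob.B‖ * ‖prob.iZ‖) with hκ
  refine ⟨fun ω => κ * ‖prob.CS ω‖ + (‖prob.C‖ * (c₀ + c₁)) * ‖Ca ω‖, fun q hq =>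
    ((prob.CS_memLp q hq).norm.const_mul _).add ((hCa q hq).norm.const_mul _), ?_⟩
  have : CompleteSpace (⊤ : Submodule ℝ V) := isClosed_univ.isComplete.completeSpace_coe
  have := fe.completeSpace
  filter_upwards [prob.a_coercive, prob.CS_bound, hfw] with ω hco hCS hfw
  have h1 : ‖prob.ctrlToObs ⊤ ω‖ ≤ κ * ‖prob.CS ω‖ := by
    refine ContinuousLinearMap.opNorm_le_bound _ (by positivity) fun u => ?_
    rw [ctrlToObs_apply prob _ hco]
    have e1 : ‖prob.load u‖ ≤ ‖prob.B‖ * ‖u‖ * ‖prob.iZ‖ :=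
      (ContinuousLinearMap.opNorm_comp_le _ _).trans
        (mul_le_mul_of_nonneg_right (prob.B.le_opNorm u) (norm_nonneg _))
    have e2 : ‖prob.state ⊤ ω u‖ ≤ ‖prob.CS ω‖ * (‖prob.B‖ * ‖u‖ * ‖prob.iZ‖) :=
      (hCS _).trans (mul_le_mul (Real.le_norm_self _) e1 (norm_nonneg _) (norm_nonneg _))
    calc _ ≤ ‖prob.obs‖ * (‖prob.CS ω‖ * (‖prob.B‖ * ‖u‖ * ‖prob.iZ‖)) :=
          (prob.obs.le_opNorm _).trans (by gcongr)
      _ = _ := by rw [hκ]; ring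
  have h2 : ∀ l, ‖prob.ctrlToObs ⊤ ω - prob.ctrlToObs (fe.space l) ω‖
      ≤ ‖prob.C‖ * (‖Ca ω‖ * fe.h l ^ αW) := by
    intro l
    have hh := (fe.h_pos l).le
    refine ContinuousLinearMap.opNorm_le_bound _ (by positivity) fun u => ?_
    rw [sub_apply, ctrlToObs_apply prob _ hco, ctrlToObs_apply prob _ hco, ← map_sub]
    refine (prob.C.le_opNorm _).trans ?_
    rw [mul_assoc]
    gcongr
    exact (hfw l u).trans (by gcongr; exact Real.le_norm_self _)
  refine ⟨h1.trans (le_add_of_nonneg_right (by positivity)), fun l => ⟨?_, ?_⟩⟩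
  · calc ‖prob.ctrlToObs (fe.space l) ω‖ ≤ ‖prob.ctrlToObs ⊤ ω‖
          + ‖prob.ctrlToObs ⊤ ω - prob.ctrlToObs (fe.space l) ω‖ := by
          rw [norm_sub_rev]; exact norm_le_norm_add_norm_sub' _ _
      _ ≤ κ * ‖prob.CS ω‖ + ‖prob.C‖ * (‖Ca ω‖ * (c₀ + c₁)) := by
          refine add_le_add h1 ((h2 l).trans ?_)
          gcongr
          linarith [hc₀' l]
      _ = _ := by ring
  · have hh := Real.rpow_pos_of_pos (fe.h_pos l) α
    calc _ ≤ ‖prob.C‖ * (‖Ca ω‖ * (c₁ * fe.h l ^ α)) := (h2 l).trans (by gcongr; exact hc₁' l)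
      _ = fe.h l ^ α * ((‖prob.C‖ * c₁) * ‖Ca ω‖) := by ring
      _ ≤ fe.h l ^ α * ((‖prob.C‖ * (c₀ + c₁)) * ‖Ca ω‖) := by gcongr; linarith
      _ ≤ _ := by
          gcongr
          exact le_add_of_nonneg_left (by positivity)

theorem isReduced (K : Submodule ℝ V) [CompleteSpace K] {D : Ω → ℝ}
    (hD : ∀ᵐ ω ∂P, ‖prob.ctrlToObs K ω‖ ≤ D ω) (hD2 : Integrable (fun ω => D ω ^ 2) P)
    (hp : ∀ u, Integrable (prob.adjointVar K u) P) :
    IsReduced P prob.B prob.yd (prob.ctrlToObs K) (prob.adjointVar K) D where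
  norm_le := hD
  sq_integrable := hD2
  integrable := hp
  dual := prob.a_coercive.mono fun _ hω => prob.B_adjointVar K hω

theorem J_eq (K : Submodule ℝ V) [CompleteSpace K] (u : U) :
    prob.J K u = 1 / 2 * (∫ ω, ‖prob.ctrlToObs K ω u - prob.yd‖ ^ 2 ∂P)
      + prob.ν / 2 * ‖u‖ ^ 2 := by
  rw [J]
  congr 2
  refine integral_congr_ae (prob.a_coercive.mono fun ω hω => ?_)
  simp only [ctrlToObs_apply prob K hω]

theorem ae_Jquad_eq [IsFiniteMeasure P] {Ω' : Type*} [MeasurableSpace Ω'] {P' : Measure Ω'}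
    {Q : RandomQuadrature Ω P'} (hQ : Q.Unbiased P) (K : Submodule ℝ V) [CompleteSpace K] (k : ℕ) :
    ∀ᵐ ω' ∂P', ∀ u, prob.Jquad Q K k ω' u
      = 1 / 2 * Q.eval k (fun ω => ‖prob.ctrlToObs K ω u - prob.yd‖ ^ 2) ω'
        + prob.ν / 2 * ‖u‖ ^ 2 := by
  filter_upwards [hQ.ae_nodes k prob.a_coercive] with ω' h u
  simp only [Jquad, RandomQuadrature.eval, ctrlToObs_apply prob K (h _)]

end RandomOCP

/-! ### Quadrature errors of the adjoint variables -/

section QuadratureError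

variable {Ω : Type*} [MeasurableSpace Ω] {P : Measure Ω}
  {Ω' : Type*} [MeasurableSpace Ω'] {P' : Measure Ω'}
  {V U H Z W : Type*}
  [NormedAddCommGroup V] [InnerProductSpace ℝ V]
  [NormedAddCommGroup U] [InnerProductSpace ℝ U]
  [NormedAddCommGroup H] [InnerProductSpace ℝ H]
  [NormedAddCommGroup Z] [InnerProductSpace ℝ Z]
  [NormedAddCommGroup W] [InnerProductSpace ℝ W]
  {prob : RandomOCP P V U H Z W} {fe : FEFamily V}
  {Q : RandomQuadrature Ω P'} {Hq : ℝ → FunctionSpace P Z} {γ : ℕ → ℝ} {αt : ℝ}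

theorem MixedRegularity.integrable_adjointVar_top (hM : MixedRegularity prob fe Hq αt) (u : U) :
    Integrable (prob.adjointVar ⊤ u) P := by
  obtain ⟨q, hq, h⟩ := hM.mixed
  obtain ⟨g, hg⟩ := (h 2 ⟨le_rfl, hq.le⟩).1 u
  exact ((Hq 2).integrable g g.2).congr hg

theorem MixedRegularity.integrable_adjointVar (hM : MixedRegularity prob fe Hq αt) (l : ℕ) (u : U) :
    Integrable (prob.adjointVar (fe.space l) u) P := by
  obtain ⟨q, hq, h⟩ := hM.mixed
  obtain ⟨g, hg⟩ := (h 2 ⟨le_rfl, hq.le⟩).2.1 l u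
  exact ((Hq 2).integrable g g.2).congr hg

theorem QuadratureAssumption.γ_nonneg (hQ : QuadratureAssumption P P' Q Hq γ) (k : ℕ) :
    0 ≤ γ k :=
  hQ.γ_antitone.le_of_tendsto hQ.γ_null k

variable [IsProbabilityMeasure P]

/-- The quadrature bound for a function `g` that agrees almost everywhere with an element of the
space `Hq q`; the nodes almost surely avoid the exceptional set. -/
theorem QuadratureAssumption.exists_error_le (hQ : QuadratureAssumption P P' Q Hq γ) {q : ℝ}
    (hq : 2 ≤ q) : ∃ c : ℝ, 0 < c ∧ ∀ (f : (Hq q).carrier) (g : Ω → Z) (k : ℕ) (m : ℝ),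
      (f : Ω → Z) =ᵐ[P] g → (Hq q).nrm f ≤ m →
      eLpNorm (Q.error P k g) (ENNReal.ofReal q) P' ≤ ENNReal.ofReal (c * m * γ k) := by
  have hQ' : Q.Unbiased P := hQ.unbiased
  obtain ⟨c, hc, h⟩ := hQ.bound q hq
  refine ⟨c, hc, fun f g k m hfg hm => ?_⟩
  rw [← eLpNorm_congr_ae (hQ'.error_congr k hfg)]
  refine (h f k).trans (ENNReal.ofReal_le_ofReal ?_)
  have := hQ.γ_nonneg k
  calc c * γ k * (Hq q).nrm f ≤ c * γ k * m := by gcongr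
    _ = _ := by ring

/-- The quadrature error of the difference of the adjoint variables on two consecutive levels is
controlled by mixed regularity. -/
theorem exists_error_adjoint_sub_le (hQ : QuadratureAssumption P P' Q Hq γ)
    (hM : MixedRegularity prob fe Hq αt) {β : ℝ} (hβ : 0 ≤ β) (hβt : β ≤ αt) :
    ∃ c : ℝ, 0 < c ∧ ∀ l k, eLpNorm (Q.error P k
        (prob.adjointVar (fe.space (l + 1)) (prob.optControl (fe.space (l + 1)))
          - prob.adjointVar (fe.space l) (prob.optControl (fe.space l)))) 2 P'
      ≤ ENNReal.ofReal (c * fe.h (l + 1) ^ β * γ k) := by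
  obtain ⟨q, hq, h⟩ := hM.mixed
  obtain ⟨CH, hCH, hg⟩ := (h 2 ⟨le_rfl, hq.le⟩).2.2
  obtain ⟨c₁, hc₁, h₁⟩ := hQ.exists_error_le le_rfl
  obtain ⟨c₂, hc₂, h₂⟩ := fe.exists_rpow_le hβt
  obtain ⟨c₃, hc₃, h₃⟩ := fe.exists_rpow_le_rpow_succ hβ
  set N := ‖prob.optControl ⊤‖ + ‖prob.yd‖
  have hN : 0 ≤ N := by positivity
  refine ⟨c₁ * (CH * (c₂ * c₃ + c₂) * (N + 1)), by positivity, fun l k => ?_⟩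
  obtain ⟨g, hg1, hg2⟩ := hg l
  obtain ⟨g', hg1', hg2'⟩ := hg (l + 1)
  have key := h₁ (g - g') (prob.adjointVar (fe.space (l + 1)) (prob.optControl (fe.space (l + 1)))
          - prob.adjointVar (fe.space l) (prob.optControl (fe.space l))) k
    (CH * (c₂ * c₃ + c₂) * (N + 1) * fe.h (l + 1) ^ β) ?_ ?_
  · rw [ENNReal.ofReal_ofNat] at key
    simpa only [mul_assoc] using key
  · filter_upwards [hg1, hg1'] with ω e e'
    simp [e, e']
  · have hh := Real.rpow_pos_of_pos (fe.h_pos (l + 1)) β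
    calc (Hq 2).nrm (g - g') ≤ (Hq 2).nrm g + (Hq 2).nrm g' := map_sub_le_add _ _ _
      _ ≤ CH * (c₂ * (c₃ * fe.h (l + 1) ^ β)) * N + CH * (c₂ * fe.h (l + 1) ^ β) * N := by
          refine add_le_add (hg2.trans ?_) (hg2'.trans ?_)
          · gcongr
            exact (h₂ l).trans (by gcongr; exact h₃ l)
          · gcongr
            exact h₂ _
      _ = CH * (c₂ * c₃ + c₂) * N * fe.h (l + 1) ^ β := by ring
      _ ≤ _ := by gcongr; linarith

/-- The quadrature error of the adjoint variables is bounded on all levels, in `L^q` for some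
`q > 2`. -/
theorem exists_error_adjoint_le (hQ : QuadratureAssumption P P' Q Hq γ)
    (hM : MixedRegularity prob fe Hq αt) :
    ∃ q : ℝ, 2 < q ∧ ∃ c : ℝ, 0 < c ∧ ∀ l k, eLpNorm (Q.error P k
        (prob.adjointVar (fe.space l) (prob.optControl (fe.space l)))) (ENNReal.ofReal q) P'
      ≤ ENNReal.ofReal (c * γ k) := by
  obtain ⟨q, hq, h⟩ := hM.mixed
  obtain ⟨hex, -, CH, hCH, hg⟩ := h q ⟨hq.le, le_rfl⟩
  obtain ⟨c₁, hc₁, h₁⟩ := hQ.exists_error_le hq.le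
  obtain ⟨c₂, hc₂, h₂⟩ := fe.exists_rpow_le (a := 0) hM.αt_pos.le
  simp only [Real.rpow_zero, mul_one] at h₂
  obtain ⟨g₀, hg₀⟩ := hex (prob.optControl ⊤)
  set N := ‖prob.optControl ⊤‖ + ‖prob.yd‖
  have hN : 0 ≤ N := by positivity
  have hg₀' : 0 ≤ (Hq q).nrm g₀ := apply_nonneg _ _
  refine ⟨q, hq, c₁ * ((Hq q).nrm g₀ + CH * c₂ * N + 1), by positivity, fun l k => ?_⟩
  obtain ⟨g, hg1, hg2⟩ := hg l
  refine h₁ (g₀ - g) _ k _ ?_ ?_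
  · filter_upwards [hg₀, hg1] with ω e e'
    simp [e, e']
  · calc (Hq q).nrm (g₀ - g) ≤ (Hq q).nrm g₀ + (Hq q).nrm g := map_sub_le_add _ _ _
      _ ≤ (Hq q).nrm g₀ + CH * c₂ * N := by
          gcongr
          exact hg2.trans (by gcongr; exact h₂ l)
      _ ≤ _ := by linarith

end QuadratureError

/-! ### The multilevel error -/

theorem integral_norm_sq_le {Ω' : Type*} [MeasurableSpace Ω'] {P' : Measure Ω'}
    {E : Type*} [NormedAddCommGroup E] {f : Ω' → E} (hf : AEStronglyMeasurable f P') {a : ℝ}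
    (ha : 0 ≤ a) (h : eLpNorm f 2 P' ≤ ENNReal.ofReal a) :
    Integrable (fun ω' => ‖f ω'‖ ^ 2) P' ∧ ∫ ω', ‖f ω'‖ ^ 2 ∂P' ≤ a ^ 2 := by
  have hm : MemLp f 2 P' := ⟨hf, h.trans_lt ENNReal.ofReal_lt_top⟩
  refine ⟨(memLp_two_iff_integrable_sq_norm hf).1 hm, ?_⟩
  rw [hm.eLpNorm_eq_integral_rpow_norm two_ne_zero ENNReal.ofNat_ne_top,
    ENNReal.ofReal_le_ofReal_iff ha] at h
  simp only [ENNReal.toReal_ofNat, Real.rpow_ofNat] at h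
  have h0 : 0 ≤ ∫ ω', ‖f ω'‖ ^ 2 ∂P' := integral_nonneg fun _ => by positivity
  rw [← one_div, ← Real.sqrt_eq_rpow] at h
  exact (Real.sqrt_le_left ha).1 h

theorem holderTriple_ofReal {a b c : ℝ} (ha : 0 < a) (hb : 0 < b) (hc : 0 < c)
    (h : a⁻¹ + b⁻¹ = c⁻¹) :
    ENNReal.HolderTriple (ENNReal.ofReal a) (ENNReal.ofReal b) (ENNReal.ofReal c) where
  inv_add_inv_eq_inv := by
    rw [← ENNReal.ofReal_inv_of_pos ha, ← ENNReal.ofReal_inv_of_pos hb,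
      ← ENNReal.ofReal_inv_of_pos hc, ← ENNReal.ofReal_add (by positivity) (by positivity), h]

section

variable {Ω : Type*} [MeasurableSpace Ω] {P : Measure Ω}
  {Ω' : Type*} [MeasurableSpace Ω'] {P' : Measure Ω'}
  {V U H Z W : Type*}
  [NormedAddCommGroup V] [InnerProductSpace ℝ V]
  [NormedAddCommGroup U] [InnerProductSpace ℝ U]
  [NormedAddCommGroup H] [InnerProductSpace ℝ H]
  [NormedAddCommGroup Z] [InnerProductSpace ℝ Z]
  [NormedAddCommGroup W] [InnerProductSpace ℝ W]
  (prob : RandomOCP P V U H Z W) (fe : FEFamily V)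
  (Q : RandomQuadrature Ω P') {Hq : ℝ → FunctionSpace P Z} {γ : ℕ → ℝ} {αW αZ αt : ℝ}

/-- The control `u^⋆_{l,∞}` with the index shifted by one; the value at `0` is `0`. -/
noncomputable def shiftedControl : ℕ → U
  | 0 => 0
  | l + 1 => prob.optControl (fe.space l)

/-- The control `u^⋆_{l,k}` with the index `l` shifted by one; the value at `l = 0` is `0`. -/
noncomputable def shiftedControlQuad : ℕ → ℕ → Ω' → U
  | 0, _, _ => 0
  | l + 1, k, ω' => prob.optControlQuad Q (fe.space l) k ω'

/-- The difference between the levels `l` and `l - 1` of the quadrature error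
`u^⋆_{l,∞} - u^⋆_{l,k}`. -/
noncomputable def levelError (l k : ℕ) (ω' : Ω') : U :=
  (shiftedControl prob fe (l + 1) - shiftedControlQuad prob fe Q (l + 1) k ω')
    - (shiftedControl prob fe l - shiftedControlQuad prob fe Q l k ω')

/-- The sparse double sum of the surpluses telescopes in the quadrature index. -/
theorem sum_surplus (L : ℕ) (ω' : Ω') :
    ∑ l ∈ Finset.range (L + 1), ∑ k ∈ Finset.range (L - l + 1), prob.surplus Q fe l k ω'
      = ∑ l ∈ Finset.range (L + 1), (prob.shiftedAdjoint Q fe (l + 1) (L - l + 1) ω'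
        - prob.shiftedAdjoint Q fe l (L - l + 1) ω') := by
  refine Finset.sum_congr rfl fun l _ => ?_
  have h0 : ∀ l, prob.shiftedAdjoint Q fe l 0 ω' = 0 := fun l => by
    cases l <;> rfl
  have h := Finset.sum_range_sub (fun k => prob.shiftedAdjoint Q fe (l + 1) k ω'
    - prob.shiftedAdjoint Q fe l k ω') (L - l + 1)
  simp only [h0, sub_zero] at h
  rw [← h]
  refine Finset.sum_congr rfl fun k _ => ?_
  rw [RandomOCP.surplus]
  abel

variable {prob fe Q}

variable [IsProbabilityMeasure P] [CompleteSpace U] [CompleteSpace H]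

/-- The error splits into the finite element error on the finest level and the quadrature errors
of the level differences. -/
theorem ae_optControl_sub_uMQ (hQ : Q.Unbiased P) {D : Ω → ℝ}
    (hR : ∀ l, IsReduced P prob.B prob.yd (prob.ctrlToObs (fe.space l))
      (prob.adjointVar (fe.space l)) D) (L : ℕ) :
    ∀ᵐ ω' ∂P', prob.optControl ⊤ - prob.uMQ Q fe L ω'
      = (prob.optControl ⊤ - prob.optControl (fe.space L))
        + ∑ l ∈ Finset.range (L + 1), levelError prob fe Q l (L - l) ω' := by
  have h1 : ∀ᵐ ω' ∂P', ∀ l k, (1 / prob.ν) • rieszAdjoint prob.B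
      (prob.shiftedAdjoint Q fe l (k + 1) ω') = shiftedControlQuad prob fe Q l k ω' := by
    refine ae_all_iff.2 fun l => ae_all_iff.2 fun k => ?_
    cases l with
    | zero =>
      refine Eventually.of_forall fun ω' => ?_
      simp [RandomOCP.shiftedAdjoint, shiftedControlQuad]
    | succ l =>
      have := fe.completeSpace l
      filter_upwards [(hR l).ae_smul_minimizer_eval hQ k prob.ν_pos
        (RandomOCP.ae_Jquad_eq hQ (fe.space l) k)] with ω' h
      change (1 / prob.ν) • rieszAdjoint prob.B (Q.eval k (prob.adjointVar (fe.space l)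
        (minimizer (prob.Jquad Q (fe.space l) k ω'))) ω') = _
      rw [← h, one_div, inv_smul_smul₀ prob.ν_pos.ne']
      rfl
  filter_upwards [h1] with ω' h1
  have h2 : prob.uMQ Q fe L ω' = ∑ l ∈ Finset.range (L + 1),
      (shiftedControlQuad prob fe Q (l + 1) (L - l) ω'
        - shiftedControlQuad prob fe Q l (L - l) ω') := by
    rw [RandomOCP.uMQ, sum_surplus, rieszAdjoint_def, map_sum, Finset.smul_sum]
    refine Finset.sum_congr rfl fun l _ => ?_
    rw [map_sub, smul_sub, h1, h1]
  have h3 : prob.optControl (fe.space L) = ∑ l ∈ Finset.range (L + 1),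
      (shiftedControl prob fe (l + 1) - shiftedControl prob fe l) := by
    rw [Finset.sum_range_sub]
    simp [shiftedControl]
  rw [h2, h3, sub_add, ← Finset.sum_sub_distrib]
  congr 1
  refine Finset.sum_congr rfl fun l _ => ?_
  rw [levelError]
  abel

variable [CompleteSpace Z] [IsProbabilityMeasure P']

/-- The quadrature errors of the level differences have the product rate `h_l^β γ_k`. Mixed
regularity bounds the part linear in the level difference; the remaining product of the operator
difference and the quadrature error on level `l - 1` is estimated by Hölder's inequality, for
which that quadrature error is needed in `L^q` with `q > 2`. -/
theorem exists_levelError_le (hQ : QuadratureAssumption P P' Q Hq γ)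
    (hM : MixedRegularity prob fe Hq αt) {D : Ω → ℝ}
    (hDq : ∀ q : ℝ, 1 ≤ q → MemLp D (ENNReal.ofReal q) P) {α β : ℝ}
    (hR : ∀ l, IsReduced P prob.B prob.yd (prob.ctrlToObs (fe.space l))
      (prob.adjointVar (fe.space l)) D)
    (hD : ∀ᵐ ω ∂P, ∀ l, ‖prob.ctrlToObs ⊤ ω - prob.ctrlToObs (fe.space l) ω‖ ≤ fe.h l ^ α * D ω)
    (hβ : 0 ≤ β) (hβα : β ≤ α) (hβt : β ≤ αt) :
    ∃ c : ℝ, 0 < c ∧ ∀ l k, AEStronglyMeasurable (levelError prob fe Q l k) P' ∧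
      eLpNorm (levelError prob fe Q l k) 2 P' ≤ ENNReal.ofReal (c * fe.h l ^ β * γ k) := by
  have hQ' : Q.Unbiased P := hQ.unbiased
  have := fe.completeSpace
  obtain ⟨q, hq, cY, hcY, hY⟩ := exists_error_adjoint_le hQ hM
  obtain ⟨cX, hcX, hX⟩ := exists_error_adjoint_sub_le hQ hM hβ hβt
  obtain ⟨c₂, hc₂, h₂⟩ := fe.exists_rpow_le hβα
  obtain ⟨c₃, hc₃, h₃⟩ := fe.exists_rpow_le_rpow_succ hβ
  have hq0 : 0 < q := by linarith
  have hq2 : 0 < q - 2 := by linarith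
  -- Hölder's inequality is applied with `1 / s + 1 / q = 1 / 2`.
  set s : ℝ := 2 * q / (q - 2) with hs
  have hs1 : 1 ≤ s := by rw [hs, le_div_iff₀ hq2]; linarith
  have hs0 : 0 < s := by linarith
  have hol1 : ENNReal.HolderTriple (ENNReal.ofReal s) (ENNReal.ofReal q) 2 := by
    have := holderTriple_ofReal hs0 hq0 two_pos (by rw [hs]; field_simp; ring)
    rwa [ENNReal.ofReal_ofNat] at this
  have hol2 : ENNReal.HolderTriple (ENNReal.ofReal (2 * s)) (ENNReal.ofReal (2 * s))
      (ENNReal.ofReal s) :=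
    holderTriple_ofReal (by positivity) (by positivity) hs0 (by field_simp; norm_num)
  have hD2 : MemLp (fun ω => 2 * D ω ^ 2) (ENNReal.ofReal s) P := by
    have := ((hDq (2 * s) (by linarith)).mul (hDq (2 * s) (by linarith))
      (r := ENNReal.ofReal s)).const_mul 2
    simpa only [pow_two, Pi.mul_apply] using this
  set m := (eLpNorm (fun ω => 2 * D ω ^ 2) (ENNReal.ofReal s) P).toReal with hm
  have hm' : eLpNorm (fun ω => 2 * D ω ^ 2) (ENNReal.ofReal s) P = ENNReal.ofReal m :=
    (ENNReal.ofReal_toReal hD2.eLpNorm_lt_top.ne).symm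
  have hm0 : 0 ≤ m := ENNReal.toReal_nonneg
  have hJm : ∀ l k, AEStronglyMeasurable (fun ω' => prob.optControlQuad Q (fe.space l) k ω') P' :=
    fun l k => (hR l).aestronglyMeasurable_minimizer hQ' k prob.ν_pos
      (RandomOCP.ae_Jquad_eq hQ' (fe.space l) k)
  have hEm : ∀ l k, AEStronglyMeasurable (Q.error P k
      (prob.adjointVar (fe.space l) (prob.optControl (fe.space l)))) P' :=
    fun l k => hQ'.aestronglyMeasurable_error k ((hR l).integrable _).aestronglyMeasurable
  have hν := prob.ν_pos
  set r := ‖rieszAdjoint prob.B‖ with hr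
  have hr0 : 0 ≤ r := norm_nonneg _
  have hh : ∀ l, 0 < fe.h l ^ β := fun l => Real.rpow_pos_of_pos (fe.h_pos l) β
  set cδ := c₂ * c₃ + c₂ with hcδ
  have hcδ0 : 0 < cδ := by positivity
  set a := prob.ν⁻¹ * r * cY / fe.h 0 ^ β
  set b := prob.ν⁻¹ * r * cX + prob.ν⁻¹ ^ 2 * r * cδ * (m * cY)
  have ha : 0 ≤ a := div_nonneg (by positivity) (hh 0).le
  have hb : 0 ≤ b := by positivity
  refine ⟨a + b + 1, by positivity, fun l k => ⟨?_, ?_⟩⟩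
  · cases l with
    | zero =>
      exact ((aestronglyMeasurable_const.sub (hJm 0 k)).sub
        (aestronglyMeasurable_const.sub aestronglyMeasurable_const))
    | succ l =>
      exact ((aestronglyMeasurable_const.sub (hJm (l + 1) k)).sub
        (aestronglyMeasurable_const.sub (hJm l k)))
  have hγ := hQ.γ_nonneg k
  have hle : ∀ x : ℝ, x ≤ a + b + 1 → ENNReal.ofReal (x * fe.h l ^ β * γ k)
      ≤ ENNReal.ofReal ((a + b + 1) * fe.h l ^ β * γ k) := fun x hx =>
    ENNReal.ofReal_le_ofReal (by have := (hh l).le; gcongr)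
  cases l with
  | zero =>
    refine le_trans ?_ (hle a (by linarith))
    have hpt : ∀ᵐ ω' ∂P', ‖levelError prob fe Q 0 k ω'‖ ≤ (prob.ν⁻¹ * r)
        * ‖Q.error P k (prob.adjointVar (fe.space 0) (prob.optControl (fe.space 0))) ω'‖ := by
      filter_upwards [(hR 0).ae_quadrature_error hQ' k hν (RandomOCP.J_eq _)
        (RandomOCP.ae_Jquad_eq hQ' (fe.space 0) k),
        Q.ae_inner_gram_nonneg (U := U) (H := H) k] with ω' h1 h2
      have h3 := (norm_le_of_regularized (h2 _) h1).trans ((rieszAdjoint prob.B).le_opNorm _)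
      have h4 : levelError prob fe Q 0 k ω' = minimizer (prob.J (fe.space 0))
          - minimizer (prob.Jquad Q (fe.space 0) k ω') := by
        simp [levelError, shiftedControl, shiftedControlQuad, RandomOCP.optControl,
          RandomOCP.optControlQuad]
      rw [h4, mul_assoc, inv_mul_eq_div, le_div_iff₀ hν, mul_comm]
      exact h3
    calc eLpNorm (levelError prob fe Q 0 k) 2 P'
        ≤ ENNReal.ofReal (prob.ν⁻¹ * r) * eLpNorm (Q.error P k
          (prob.adjointVar (fe.space 0) (prob.optControl (fe.space 0)))) 2 P' :=
          eLpNorm_le_mul_eLpNorm_of_ae_le_mul hpt 2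
      _ ≤ ENNReal.ofReal (prob.ν⁻¹ * r) * ENNReal.ofReal (cY * γ k) := by
          gcongr
          refine (eLpNorm_le_eLpNorm_of_exponent_le ?_ (hEm 0 k)).trans (hY 0 k)
          rw [← ENNReal.ofReal_ofNat]
          exact ENNReal.ofReal_le_ofReal hq.le
      _ = ENNReal.ofReal (a * fe.h 0 ^ β * γ k) := by
          rw [← ENNReal.ofReal_mul (by positivity), div_mul_cancel₀ _ (hh 0).ne']
          congr 1
          ring
  | succ l =>
    refine le_trans ?_ (hle b (by linarith))
    have hTT : ∀ᵐ ω ∂P, ‖prob.ctrlToObs (fe.space (l + 1)) ω - prob.ctrlToObs (fe.space l) ω‖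
        ≤ (cδ * fe.h (l + 1) ^ β) * D ω := by
      filter_upwards [hD, (hR l).norm_le] with ω hω hω'
      have hD0 : 0 ≤ D ω := (norm_nonneg _).trans hω'
      calc _ ≤ ‖prob.ctrlToObs (fe.space (l + 1)) ω - prob.ctrlToObs ⊤ ω‖
            + ‖prob.ctrlToObs ⊤ ω - prob.ctrlToObs (fe.space l) ω‖ :=
            norm_sub_le_norm_sub_add_norm_sub _ _ _
        _ ≤ fe.h (l + 1) ^ α * D ω + fe.h l ^ α * D ω := by
            rw [norm_sub_rev]
            exact add_le_add (hω (l + 1)) (hω l)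
        _ ≤ (c₂ * fe.h (l + 1) ^ β) * D ω + (c₂ * (c₃ * fe.h (l + 1) ^ β)) * D ω := by
            gcongr
            · exact h₂ _
            · exact (h₂ l).trans (by gcongr; exact h₃ l)
        _ = _ := by rw [hcδ]; ring
    have hpt := (hR (l + 1)).ae_norm_quadrature_error_sub_le (hR l) hQ' k hTT hν
      (RandomOCP.J_eq _) (RandomOCP.J_eq _) (RandomOCP.ae_Jquad_eq hQ' (fe.space (l + 1)) k)
      (RandomOCP.ae_Jquad_eq hQ' (fe.space l) k)
    set X := Q.error P k
      (prob.adjointVar (fe.space (l + 1)) (prob.optControl (fe.space (l + 1)))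
        - prob.adjointVar (fe.space l) (prob.optControl (fe.space l))) with hXdef
    set Y := Q.error P k (prob.adjointVar (fe.space l) (prob.optControl (fe.space l))) with hYdef
    set M := Q.eval k (fun ω => 2 * D ω ^ 2) with hMdef
    have hMm : AEStronglyMeasurable M P' :=
      hQ'.aestronglyMeasurable_eval k hD2.aestronglyMeasurable
    have hXm : AEStronglyMeasurable X P' := hQ'.aestronglyMeasurable_error k
      (((hR (l + 1)).integrable _).sub ((hR l).integrable _)).aestronglyMeasurable
    have hMY : eLpNorm (M • Y) 2 P' ≤ ENNReal.ofReal (m * (cY * γ k)) := by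
      rw [ENNReal.ofReal_mul hm0, ← hm']
      refine (eLpNorm_smul_le_mul_eLpNorm (hEm l k) hMm (p := ENNReal.ofReal s)
        (q := ENNReal.ofReal q)).trans ?_
      exact mul_le_mul' (hQ'.eLpNorm_eval_le k hs1 hD2 fun ω => by positivity) (hY l k)
    have hpt' : ∀ᵐ ω' ∂P', ‖levelError prob fe Q (l + 1) k ω'‖
        ≤ (prob.ν⁻¹ * r) * ‖X ω'‖
          + (prob.ν⁻¹ ^ 2 * r * (cδ * fe.h (l + 1) ^ β)) * ‖(M • Y) ω'‖ := by
      filter_upwards [hpt] with ω' h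
      rw [hXdef, Q.error_sub k ((hR (l + 1)).integrable _) ((hR l).integrable _)]
      exact h
    set A := prob.ν⁻¹ * r with hA
    set A' := prob.ν⁻¹ ^ 2 * r * (cδ * fe.h (l + 1) ^ β) with hA'
    have hA0 : 0 ≤ A := by positivity
    have hA'0 : 0 ≤ A' := mul_nonneg (by positivity) (mul_nonneg hcδ0.le (hh _).le)
    calc eLpNorm (levelError prob fe Q (l + 1) k) 2 P'
        ≤ eLpNorm ((fun ω' => A * ‖X ω'‖) + fun ω' => A' * ‖(M • Y) ω'‖) 2 P' :=
          eLpNorm_mono_ae_real hpt'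
      _ ≤ eLpNorm (fun ω' => A * ‖X ω'‖) 2 P' + eLpNorm (fun ω' => A' * ‖(M • Y) ω'‖) 2 P' :=
          eLpNorm_add_le (hXm.norm.const_mul _) ((hMm.smul (hEm l k)).norm.const_mul _)
            one_le_two
      _ ≤ ENNReal.ofReal A * eLpNorm X 2 P' + ENNReal.ofReal A' * eLpNorm (M • Y) 2 P' := by
          refine add_le_add (eLpNorm_le_mul_eLpNorm_of_ae_le_mul
            (Eventually.of_forall fun ω' => ?_) 2) (eLpNorm_le_mul_eLpNorm_of_ae_le_mul
            (Eventually.of_forall fun ω' => ?_) 2)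
          · rw [norm_mul, norm_norm, Real.norm_of_nonneg hA0]
          · rw [norm_mul, norm_norm, Real.norm_of_nonneg hA'0]
      _ ≤ ENNReal.ofReal A * ENNReal.ofReal (cX * fe.h (l + 1) ^ β * γ k)
          + ENNReal.ofReal A' * ENNReal.ofReal (m * (cY * γ k)) := by
          gcongr
          exact hX l k
      _ = _ := by
          have := hh (l + 1)
          rw [← ENNReal.ofReal_mul hA0, ← ENNReal.ofReal_mul hA'0,
            ← ENNReal.ofReal_add (by positivity) (by positivity), hA, hA']
          congr 1
          ring

end

end MLQ

theorem mainTheorem1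
    {Ω : Type*} [MeasurableSpace Ω] (P : Measure Ω) [IsProbabilityMeasure P]
    {Ω' : Type*} [MeasurableSpace Ω'] (P' : Measure Ω') [IsProbabilityMeasure P']
    {V U H Z W : Type*}
    [NormedAddCommGroup V] [InnerProductSpace ℝ V] [CompleteSpace V]
    [TopologicalSpace.SeparableSpace V]
    [NormedAddCommGroup U] [InnerProductSpace ℝ U] [CompleteSpace U]
    [NormedAddCommGroup H] [InnerProductSpace ℝ H] [CompleteSpace H]
    [NormedAddCommGroup Z] [InnerProductSpace ℝ Z] [CompleteSpace Z]
    [NormedAddCommGroup W] [InnerProductSpace ℝ W] [CompleteSpace W]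
    (prob : MLQ.RandomOCP P V U H Z W) (fe : MLQ.FEFamily V)
    (Q : MLQ.RandomQuadrature Ω P') (Hq : ℝ → MLQ.FunctionSpace P Z)
    (γ : ℕ → ℝ) (αW αZ αt : ℝ)
    (hQ : MLQ.QuadratureAssumption P P' Q Hq γ)
    (hF : MLQ.FEAssumption prob fe αW αZ)
    (hM : MLQ.MixedRegularity prob fe Hq αt) :
    ∃ C₁ : ℝ, 0 < C₁ ∧ ∃ C₃ : ℝ, 0 < C₃ ∧ ∀ L : ℕ,
      Integrable (fun ω' => ‖prob.optControl ⊤ - prob.uMQ Q fe L ω'‖ ^ 2) P' ∧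
      ∫ ω', ‖prob.optControl ⊤ - prob.uMQ Q fe L ω'‖ ^ 2 ∂P'
        ≤ 2 * C₁ ^ 2 * fe.h L ^ (2 * min αW αZ)
          + C₃ ^ 2 * L * ∑ l ∈ Finset.range (L + 1),
              fe.h l ^ (2 * min (min αW αZ) αt) * γ (L - l) ^ 2 := by
  set α := min αW αZ with hα
  set β := min α αt with hβdef
  have hα0 : 0 < α := lt_min hF.αW_pos hF.αZ_pos
  have hβ : 0 ≤ β := le_min hα0.le hM.αt_pos.le
  have hQ' : Q.Unbiased P := hQ.unbiased
  obtain ⟨D, hDq, hD⟩ := MLQ.RandomOCP.exists_bound hF (min_le_left αW αZ)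
  have hD1 : Integrable D P := by
    simpa [memLp_one_iff_integrable] using hDq 1 le_rfl
  have hD2 : Integrable (fun ω => D ω ^ 2) P := by
    have := hDq 2 one_le_two
    rw [ENNReal.ofReal_ofNat] at this
    exact this.integrable_sq
  have := fe.completeSpace
  have : CompleteSpace (⊤ : Submodule ℝ V) := isClosed_univ.isComplete.completeSpace_coe
  have hRtop : MLQ.IsReduced P prob.B prob.yd (prob.ctrlToObs ⊤) (prob.adjointVar ⊤) D :=
    MLQ.RandomOCP.isReduced ⊤ (hD.mono fun ω h => h.1) hD2 hM.integrable_adjointVar_top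
  have hR : ∀ l, MLQ.IsReduced P prob.B prob.yd (prob.ctrlToObs (fe.space l))
      (prob.adjointVar (fe.space l)) D := fun l =>
    MLQ.RandomOCP.isReduced _ (hD.mono fun ω h => (h.2 l).1) hD2 (hM.integrable_adjointVar l)
  obtain ⟨c, hc, hlev⟩ := MLQ.exists_levelError_le hQ hM hDq hR
    (hD.mono fun ω h l => (h.2 l).2) hβ (min_le_left α αt) (min_le_right α αt)
  have hh : ∀ l, 0 < fe.h l ^ α := fun l => Real.rpow_pos_of_pos (fe.h_pos l) α
  have hhβ : ∀ l, 0 < fe.h l ^ β := fun l => Real.rpow_pos_of_pos (fe.h_pos l) β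
  have hsq : ∀ (l : ℕ) (a : ℝ), fe.h l ^ (2 * a) = (fe.h l ^ a) ^ 2 := fun l a => by
    rw [mul_comm, Real.rpow_mul (fe.h_pos l).le, Real.rpow_ofNat]
  have hfe : ∃ A : ℝ, ∀ L, ‖prob.optControl ⊤ - prob.optControl (fe.space L)‖
      ≤ fe.h L ^ α * A := by
    refine ⟨prob.ν⁻¹ * (‖prob.yd‖ * (∫ ω, D ω ∂P)
      + 2 * (∫ ω, D ω ^ 2 ∂P) * ‖prob.optControl ⊤‖), fun L => ?_⟩
    rw [norm_sub_rev]
    exact hRtop.norm_minimizer_sub_le (hR L) hD1 (hh L).le (hD.mono fun ω h => (h.2 L).2)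
      prob.ν_pos (MLQ.RandomOCP.J_eq _) (MLQ.RandomOCP.J_eq _)
  obtain ⟨A, hA⟩ := hfe
  have hlev2 : ∀ l k, Integrable (fun ω' => ‖MLQ.levelError prob fe Q l k ω'‖ ^ 2) P' ∧
      ∫ ω', ‖MLQ.levelError prob fe Q l k ω'‖ ^ 2 ∂P' ≤ (c * fe.h l ^ β * γ k) ^ 2 := fun l k =>
    MLQ.integral_norm_sq_le (hlev l k).1
      (mul_nonneg (mul_nonneg hc.le (hhβ l).le) (hQ.γ_nonneg k)) (hlev l k).2
  -- For `L = 0` the sum on the right carries the factor `L = 0`, so the quadrature error has to be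
  -- absorbed by the first term; the summand `E ^ 2` of its constant serves this purpose.
  set E := (c * fe.h 0 ^ β * γ 0) / fe.h 0 ^ α with hE
  have hC₁ : 0 < A ^ 2 + E ^ 2 + 1 := by positivity
  refine ⟨√(A ^ 2 + E ^ 2 + 1), Real.sqrt_pos.2 hC₁, 2 * c, by positivity, fun L => ?_⟩
  rw [Real.sq_sqrt hC₁.le, hsq]
  have hsplit := MLQ.ae_optControl_sub_uMQ hQ' hR L
  set x := prob.optControl ⊤ - prob.optControl (fe.space L)
  have hpt : ∀ᵐ ω' ∂P', ‖prob.optControl ⊤ - prob.uMQ Q fe L ω'‖ ^ 2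
      ≤ 2 * ‖x‖ ^ 2 + 2 * ((L + 1 : ℝ) * ∑ l ∈ Finset.range (L + 1),
        ‖MLQ.levelError prob fe Q l (L - l) ω'‖ ^ 2) := by
    filter_upwards [hsplit] with ω' h
    rw [h]
    set S := ∑ l ∈ Finset.range (L + 1), MLQ.levelError prob fe Q l (L - l) ω'
    have h1 : ‖S‖ ^ 2 ≤ (L + 1 : ℝ) * ∑ l ∈ Finset.range (L + 1),
        ‖MLQ.levelError prob fe Q l (L - l) ω'‖ ^ 2 := by
      refine (pow_le_pow_left₀ (norm_nonneg _) (norm_sum_le _ _) 2).trans ?_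
      simpa using sq_sum_le_card_mul_sum_sq (s := Finset.range (L + 1))
        (f := fun l => ‖MLQ.levelError prob fe Q l (L - l) ω'‖)
    have h2 : ‖x + S‖ ^ 2 ≤ (‖x‖ + ‖S‖) ^ 2 :=
      pow_le_pow_left₀ (norm_nonneg _) (norm_add_le _ _) 2
    nlinarith [sq_nonneg (‖x‖ - ‖S‖)]
  have hint : Integrable (fun ω' => 2 * ‖x‖ ^ 2 + 2 * ((L + 1 : ℝ) *
      ∑ l ∈ Finset.range (L + 1), ‖MLQ.levelError prob fe Q l (L - l) ω'‖ ^ 2)) P' :=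
    (integrable_const _).add (((integrable_finsetSum _ fun l _ =>
      (hlev2 l (L - l)).1).const_mul _).const_mul 2)
  have hmeas : AEStronglyMeasurable (fun ω' => prob.optControl ⊤ - prob.uMQ Q fe L ω') P' :=
    (aestronglyMeasurable_const.add (Finset.aestronglyMeasurable_fun_sum _ fun l _ =>
      (hlev l (L - l)).1)).congr (hsplit.mono fun ω' h => h.symm)
  have hint' : Integrable (fun ω' => ‖prob.optControl ⊤ - prob.uMQ Q fe L ω'‖ ^ 2) P' :=
    hint.mono' (hmeas.norm.pow 2) (hpt.mono fun ω' h => by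
      rwa [Real.norm_of_nonneg (by positivity)])
  refine ⟨hint', (integral_mono_ae hint' hint hpt).trans ?_⟩
  have hx : ‖x‖ ^ 2 ≤ A ^ 2 * (fe.h L ^ α) ^ 2 := by
    rw [← mul_pow, mul_comm A]
    exact pow_le_pow_left₀ (norm_nonneg _) (hA L) 2
  have hval : ∫ ω', (2 * ‖x‖ ^ 2 + 2 * ((L + 1 : ℝ) * ∑ l ∈ Finset.range (L + 1),
      ‖MLQ.levelError prob fe Q l (L - l) ω'‖ ^ 2)) ∂P'
      ≤ 2 * (A ^ 2 * (fe.h L ^ α) ^ 2) + 2 * ((L + 1 : ℝ) * ∑ l ∈ Finset.range (L + 1),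
        (c * fe.h l ^ β * γ (L - l)) ^ 2) := by
    have hi : Integrable (fun ω' => 2 * ((L + 1 : ℝ) * ∑ l ∈ Finset.range (L + 1),
        ‖MLQ.levelError prob fe Q l (L - l) ω'‖ ^ 2)) P' :=
      ((integrable_finsetSum _ fun l _ => (hlev2 l (L - l)).1).const_mul _).const_mul 2
    rw [integral_add (integrable_const _) hi, integral_const, integral_const_mul,
      integral_const_mul, integral_finsetSum _ fun l _ => (hlev2 l (L - l)).1]
    simp only [probReal_univ, one_smul]
    gcongr with l hl
    exact (hlev2 l (L - l)).2
  refine hval.trans ?_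
  have hsum : ∑ l ∈ Finset.range (L + 1), (c * fe.h l ^ β * γ (L - l)) ^ 2
      = c ^ 2 * ∑ l ∈ Finset.range (L + 1), fe.h l ^ (2 * β) * γ (L - l) ^ 2 := by
    rw [Finset.mul_sum]
    refine Finset.sum_congr rfl fun l _ => ?_
    rw [hsq]
    ring
  have hS0 : 0 ≤ ∑ l ∈ Finset.range (L + 1), fe.h l ^ (2 * β) * γ (L - l) ^ 2 :=
    Finset.sum_nonneg fun l _ => by rw [hsq]; positivity
  rcases Nat.eq_zero_or_pos L with rfl | hL
  · have hE' : (c * fe.h 0 ^ β * γ 0) ^ 2 = E ^ 2 * (fe.h 0 ^ α) ^ 2 := by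
      rw [← mul_pow, hE, div_mul_cancel₀ _ (hh 0).ne']
    simp only [zero_add, Finset.sum_range_one, Nat.sub_self, Nat.cast_zero, one_mul, mul_zero,
      zero_mul, add_zero, hE']
    nlinarith [sq_nonneg (fe.h 0 ^ α)]
  · rw [hsum]
    set S := ∑ l ∈ Finset.range (L + 1), fe.h l ^ (2 * β) * γ (L - l) ^ 2
    have hL1 : (1 : ℝ) ≤ L := by exact_mod_cast hL
    have h1 : (L + 1 : ℝ) * (c ^ 2 * S) ≤ 2 * L * (c ^ 2 * S) := by
      have : 0 ≤ c ^ 2 * S := by positivity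
      gcongr
      linarith
    have h2 : A ^ 2 * (fe.h L ^ α) ^ 2 ≤ (A ^ 2 + E ^ 2 + 1) * (fe.h L ^ α) ^ 2 := by
      gcongr
      nlinarith [sq_nonneg E]
    linarith
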